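/- Let $M$ be a compact finite-dimensional smooth manifold, possibly with boundary, endowed with a smooth Riemannian metric $\langle\cdot,\cdot\rangle$ with norm $\|\cdot\|$, and let $G$ be a $C^1$ vector field on $M$ whose integral curves starting in $M$ are defined, and stay in $M$, for all times $t\ge 0$ (this is automatic if $M$ has no boundary, or if $G$ is inwardly transverse to $\partial M$). Let $\phi_t$ be the flow generated by $G$, and for $x\in M$ let $J_x\supseteq[0,\infty)$ be the maximal interval of existence of $t\mapsto\phi_t x$; thus $J_x=\mathbb R$ for all $x$ if $\partial M=\emptyset$. Let $D\phi_t(x):T_xM\to T_{\phi_t x}M$ be the derivative of $\phi_t$ with respect to $x$. Let $T^1M$ be the unit tangent bundle and let $\mathrm{Sing}(G)$ be the zero set of $G$. For $x\in M\setminus\mathrm{Sing}(G)$ let $N_x=G(x)^\perp\subset T_xM$, let $O_x:T_xM\to N_x$ be the orthogonal projection, and let $P^t_x=O_{\phi_t x}\circ D\phi_t(x):N_x\to N_{\phi_t x}$ be the linear Poincaré flow. Let $G^\perp$ be the bundle of the $N_x$ over $M\setminus\mathrm{Sing}(G)$ and $N^1=T^1M\cap G^\perp$. Put $$\Phi_t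 v=\frac{D\phi_t v}{\|D\phi_t v\|}\quad(v\in T^1M),\qquad \widehat\Phi_t v=\frac{P^t v}{\|P^t v\|}\quad(v\in N^1).$$ We regard $D\phi_t$ and $P^t$ as maps of the bundles $TM$ and $G^\perp$ over $\phi_t$, and $D\phi_t^{-1}$, $(P^t)^{-1}$ as the inverse bundle maps: for $w\in T_{y}M$ with $y=\phi_t x$, $D\phi_t^{-1}w=(D\phi_t(x))^{-1}w\in T_xM$, and similarly for $P^t$. **Theorem.** For every $t\in\mathbb R$ the map $\phi_t$ is differentiable on its domain $\{x: t\in J_x\}$, and $D\phi_t$, respectively $P^t$, is a bijection from the vectors of $TM$, respectively $G^\perp$, based at points $x$ with $t\in J_x$ onto those based at points $y$ with $-t\in J_y$. Moreover, the limits $$D_G(v)=\lim_{h\to0}\tfrac1h\ln\|D\phi_h v\|,\qquad \tilde D_G(v)=\lim_{h\to0}\tfrac1h\ln\|D\phi_h^{-1}v\|\qquad(v\in T^1M),$$ $$D(v)=\lim_{h\to0}\tfrac1h\ln\|P^h v\|,\qquad \tilde D(v)=\lim_{h\to0}\tfrac1h\ln\|(P^h)^{-1}v\|\qquad(v\in N^1)$$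 exist, where for $v$ based at $x$ the limit is over $h\ne0$ with $h\in J_x$ (for $D_G$, $D$) or $-h\in J_x$ (for $\tilde D_G$, $\tilde D$), so over all small $h\neq0$ if $\partial M=\emptyset$. The functions $D_G,\tilde D_G$ are continuous and bounded on $T^1M$, and $D,\tilde D$ are continuous and bounded on $N^1$. For $w\in T^1_yM$ and $v\in N^1$ based at $x$, $$\ln\|D\phi_t w\|=\int_0^t D_G(\Phi_s w)\,ds\quad(t\in J_y),\qquad \ln\|P^t v\|=\int_0^t D(\widehat\Phi_s v)\,ds\quad(t\in J_x),$$ $$\ln\|D\phi_t^{-1} w\|=\int_0^t \tilde D_G(\Phi_{-s} w)\,ds\quad(-t\in J_y),\qquad \ln\|(P^t)^{-1} v\|=\int_0^t \tilde D(\widehat\Phi_{-s} v)\,ds\quad(-t\in J_x),$$ and, equivalently to the last two, $$\ln\|D\phi_t^{-1}(\Phi_t w)\|=\int_0^t \tilde D_G(\Phi_{s} w)\,ds\quad(t\in J_y),\qquad \ln\|(P^t)^{-1} (\widehat\Phi_t v)\|=\int_0^t \tilde D(\widehat\Phi_{s} v)\,ds\quad(t\in J_x).$$ All the integrands are integrable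 on the intervals of integration. -/

import Mathlib

open Set Filter Topology Bundle Manifold
open scoped ContDiff

noncomputable section

namespace LinearPoincareFlow

variable {E : Type*} [NormedAddCommGroup E] [NormedSpace ℝ E]
  {H : Type*} [TopologicalSpace H] {I : ModelWithCorners ℝ E H}
  {M : Type*} [TopologicalSpace M] [ChartedSpace H M]

/-- The maximal interval of existence of the integral curve of `G` through `x` at time `0`: the
times `t` that are reached by an integral curve of `G` inside `M`. It is all of `ℝ` if `M` is a
compact manifold without boundary and `G` is `C^1`. -/
def flowDomain (G : (x : M) → TangentSpace I x) (x : M) : Set ℝ :=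
  {t | ∃ γ : ℝ → M, γ 0 = x ∧ IsMIntegralCurveOn γ G (uIcc 0 t)}

/-- `φ` is the flow generated by `G`: every point has its whole forward orbit inside `M` (as is
the case on a compact manifold `M` when `M` has no boundary, or when `G` is inwardly transverse to
the boundary), and `t ↦ φ t x` is the maximal integral curve of `G` through `x`. The values
`φ t x` with `t` outside of `flowDomain G x` are irrelevant. -/
structure IsFlowOf (G : (x : M) → TangentSpace I x) (φ : ℝ → M → M) : Prop where
  mem_flowDomain : ∀ (x : M) (t : ℝ), 0 ≤ t → t ∈ flowDomain G x
  map_zero : ∀ x : M, φ 0 x = x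
  isMIntegralCurveOn : ∀ x : M, IsMIntegralCurveOn (fun t ↦ φ t x) G (flowDomain G x)

variable [RiemannianBundle (fun x : M ↦ TangentSpace I x)]

variable (I M) in
/-- The unit tangent bundle `T¹M`. -/
def unitTangentBundle : Set (TangentBundle I M) := {v | ‖v.2‖ = 1}

/-- The normal bundle `G^⊥` over the regular points of `G`. -/
def normalBundle (G : (x : M) → TangentSpace I x) : Set (TangentBundle I M) :=
  {v | G v.1 ≠ 0 ∧ inner ℝ v.2 (G v.1) = 0}

/-- The tangent vector `v / ‖v‖`. -/
def normalize (v : TangentBundle I M) : TangentBundle I M := ⟨v.1, ‖v.2‖⁻¹ • v.2⟩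

/-- The inverse of `f` restricted to `s`, evaluated at `w`. -/
def inverseOn {α : Type*} (f : α → α) (s : Set α) (w : α) : α :=
  @Function.invFunOn α α ⟨w⟩ f s w

/-- The derivative `Dφ_t` of the flow with respect to the point, as a map of the tangent bundle
over `φ_t`. The derivative is taken inside the set of points on which `φ_t` is defined, which is
all of `M` when `0 ≤ t`. -/
def flowDeriv (G : (x : M) → TangentSpace I x) (φ : ℝ → M → M) (t : ℝ) :
    TangentBundle I M → TangentBundle I M :=
  tangentMapWithin I I (φ t) {x | t ∈ flowDomain G x}

/-- The inverse `Dφ_t⁻¹`, as a map of the tangent bundle over `φ_t⁻¹ = φ_{-t}`: on a vector `w`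
based at `φ_t x` it is `(Dφ_t(x))⁻¹ w`. -/
def flowDerivInv (G : (x : M) → TangentSpace I x) (φ : ℝ → M → M) (t : ℝ) :
    TangentBundle I M → TangentBundle I M :=
  inverseOn (flowDeriv G φ t) {v | t ∈ flowDomain G v.1}

/-- The orthogonal projection `O_x` of `T_x M` onto the orthogonal complement of `G x`. -/
def normalProj (G : (x : M) → TangentSpace I x) (v : TangentBundle I M) : TangentBundle I M :=
  ⟨v.1, (ℝ ∙ G v.1)ᗮ.starProjection v.2⟩

/-- The linear Poincaré flow `P^t = O ∘ Dφ_t`, to be applied to vectors of the normal bundle. -/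
def poincare (G : (x : M) → TangentSpace I x) (φ : ℝ → M → M) (t : ℝ)
    (v : TangentBundle I M) : TangentBundle I M :=
  normalProj G (flowDeriv G φ t v)

/-- The inverse `(P^t)⁻¹` of the linear Poincaré flow on the normal bundle. -/
def poincareInv (G : (x : M) → TangentSpace I x) (φ : ℝ → M → M) (t : ℝ) :
    TangentBundle I M → TangentBundle I M :=
  inverseOn (poincare G φ t) {v | v ∈ normalBundle G ∧ t ∈ flowDomain G v.1}

/-- The induced flow `Φ_t v = Dφ_t v / ‖Dφ_t v‖` on the unit tangent bundle. -/
def unitFlow (G : (x : M) → TangentSpace I x) (φ : ℝ → M → M) (t : ℝ)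
    (v : TangentBundle I M) : TangentBundle I M :=
  normalize (flowDeriv G φ t v)

/-- The induced flow `v ↦ P^t v / ‖P^t v‖` on the unit normal bundle. -/
def unitNormalFlow (G : (x : M) → TangentSpace I x) (φ : ℝ → M → M) (t : ℝ)
    (v : TangentBundle I M) : TangentBundle I M :=
  normalize (poincare G φ t v)

end LinearPoincareFlow

end

open LinearPoincareFlow

/-! All four generators are plus or minus one function, `logRate`: half the derivative at $s=0$ of
$\|D\phi_s v\|^2$.

Read in a chart, the pair $(\phi_s x, D\phi_s v)$ solves the first-order system $p'=G(p)$,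
$\xi'=DG(p)\xi$. The derivative of any $C^1$ function on $TM$ along this pair is therefore given by
the chain rule in terms of $G$ and $DG$ alone. So `logRate` is continuous on all of $TM$, although
$G$ is only $C^1$ (`continuous_flowRate`). It is bounded on unit vectors by local compactness
estimates and a finite cover of $M$ (`exists_abs_logRate_le`).

The same function serves the linear Poincaré flow. Since $D\phi_s$ carries $G$ to $G$, one has
$\|P^s v\|^2=\|D\phi_s v\|^2-\langle D\phi_s v,G\rangle^2/\|G\|^2$. For $v\perp G$ the subtracted
term is the square of a quantity vanishing at $s=0$, so it does not contribute to the derivative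
(`hasDerivWithinAt_norm_sq_poincare`). Hence the bound on $N^1$ survives near the zeros of $G$,
where $N^1$ fails to be compact.

The rest is a cocycle argument (`IsRateOf`). The flow law and linearity on fibres turn the
derivative at time zero into the derivative of $\ln\|A_t v\|$ at every time, which is integrated.
The inverse maps are the maps at time $-t$, which changes the sign of the generator.

The boundary makes the flow only partial: negative times exist on the image of $\phi_s$ only.
Everything is first proved for nonnegative times, where $\phi_t$ is defined on all of $M$, is
injective, and has injective derivative. `IsPartialFlow` derives the law for times of either sign
from the forward semigroup and its inverses, once for $\phi_t$, $D\phi_t$ and $P^t$. -/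

/-! ### The variational equation in a normed space. -/

section Euclidean

variable {E : Type*} [NormedAddCommGroup E] [NormedSpace ℝ E]

/-- Uniform differentiability of a `C^1` function on a compact convex set. -/
theorem Convex.exists_forall_norm_sub_sub_le_of_isCompact {K : Set E} (hK : Convex ℝ K)
    (hc : IsCompact K) {f : E → E} {f' : E → E →L[ℝ] E}
    (hf : ∀ p ∈ K, HasFDerivWithinAt f (f' p) K p) (hf' : ContinuousOn f' K)
    {ε : ℝ} (hε : 0 < ε) :
    ∃ δ > 0, ∀ p ∈ K, ∀ q ∈ K, ‖q - p‖ < δ → ‖f q - f p - f' p (q - p)‖ ≤ ε * ‖q - p‖ := by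
  have hu := hc.uniformContinuousOn_of_continuous hf'
  obtain ⟨δ, hδ, h⟩ := Metric.uniformContinuousOn_iff.1 hu ε hε
  refine ⟨δ, hδ, fun p hp q hq hpq ↦ ?_⟩
  refine Convex.norm_image_sub_le_of_norm_hasFDerivWithin_le' (s := K ∩ Metric.ball p δ)
    (f' := f') (fun x hx ↦ (hf x hx.1).mono inter_subset_left) (fun x hx ↦ ?_)
    (hK.inter (convex_ball p δ)) ⟨hp, Metric.mem_ball_self hδ⟩ ⟨hq, by simpa [dist_eq_norm]⟩
  rw [← dist_eq_norm]
  exact (h x hx.1 p hp hx.2).le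

/-- A linear differential equation has a fundamental solution on short intervals. -/
theorem exists_fundamental_solution [CompleteSpace E] {A : ℝ → E →L[ℝ] E} {a L : ℝ}
    (ha : 0 ≤ a) (hA : ContinuousOn A (Icc 0 a)) (hL : ∀ t ∈ Icc 0 a, ‖A t‖ ≤ L)
    (haL : 2 * L * a ≤ 1) :
    ∃ Z : ℝ → E →L[ℝ] E, Z 0 = ContinuousLinearMap.id ℝ E ∧
      ∀ t ∈ Icc 0 a, HasDerivWithinAt Z ((A t).comp (Z t)) (Icc 0 a) t := by
  have hL0 : 0 ≤ L := (norm_nonneg _).trans (hL 0 ⟨le_rfl, ha⟩)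
  lift L to NNReal using hL0
  -- On the ball of radius 1 about the identity $\|Z\|\le 2$, so the field is bounded by $2L$. The
  -- hypothesis $2La\le 1$ then keeps the solution in that ball.
  have hPL : IsPicardLindelof (fun t (Z : E →L[ℝ] E) ↦ (A t).comp Z) (tmin := 0) (tmax := a)
      ⟨0, le_rfl, ha⟩ (ContinuousLinearMap.id ℝ E) 1 0 (2 * L) L := by
    refine ⟨fun t ht ↦ ?_, fun Z _ ↦ ?_, fun t ht Z hZ ↦ ?_, ?_⟩
    · refine LipschitzOnWith.of_dist_le_mul fun Z _ Y _ ↦ ?_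
      rw [dist_eq_norm, dist_eq_norm, ← ContinuousLinearMap.comp_sub]
      exact (ContinuousLinearMap.opNorm_comp_le _ _).trans
        (mul_le_mul_of_nonneg_right (hL t ht) (norm_nonneg _))
    · exact hA.clm_comp continuousOn_const
    · have hZ2 : ‖Z‖ ≤ 2 := by
        have h1 : ‖Z - ContinuousLinearMap.id ℝ E‖ ≤ 1 := by
          simpa [dist_eq_norm] using hZ
        have h2 : ‖ContinuousLinearMap.id ℝ E‖ ≤ 1 := ContinuousLinearMap.norm_id_le
        calc ‖Z‖ = ‖(Z - ContinuousLinearMap.id ℝ E) + ContinuousLinearMap.id ℝ E‖ := by simp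
          _ ≤ 1 + 1 := (norm_add_le _ _).trans (add_le_add h1 h2)
          _ = 2 := by norm_num
      calc ‖(A t).comp Z‖ ≤ ‖A t‖ * ‖Z‖ := ContinuousLinearMap.opNorm_comp_le _ _
        _ ≤ L * 2 := mul_le_mul (hL t ht) hZ2 (norm_nonneg _) L.2
        _ = _ := by push_cast; ring
    · simpa [ha] using haL
  exact hPL.exists_eq_forall_mem_Icc_hasDerivWithinAt₀

/-- Backward uniqueness: if $Z_t v=0$, then $Z_s v$ solves the linear equation with zero final
value, so it vanishes on $[0,t]$, and its value at $0$ is $v$. -/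
theorem fundamental_solution_injective {A Z : ℝ → E →L[ℝ] E} {a L : ℝ}
    (hL : ∀ t ∈ Icc 0 a, ‖A t‖ ≤ L) (hZ0 : Z 0 = ContinuousLinearMap.id ℝ E)
    (hZ : ∀ t ∈ Icc 0 a, HasDerivWithinAt Z ((A t).comp (Z t)) (Icc 0 a) t)
    {t : ℝ} (ht : t ∈ Icc 0 a) : Function.Injective (Z t) := by
  rw [injective_iff_map_eq_zero]
  intro v hv
  have hsub : Icc 0 t ⊆ Icc 0 a := Icc_subset_Icc_right ht.2
  have hL0 : 0 ≤ L := (norm_nonneg _).trans (hL t ht)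
  lift L to NNReal using hL0
  have hd (s : ℝ) (hs : s ∈ Icc 0 t) :
      HasDerivWithinAt (fun s ↦ Z s v) (A s (Z s v)) (Icc 0 t) s := by
    simpa using ((hZ s (hsub hs)).mono hsub).clm_apply (hasDerivWithinAt_const s _ v)
  have key : EqOn (fun s ↦ Z s v) (fun _ ↦ 0) (Icc 0 t) := by
    refine ODE_solution_unique_of_mem_Icc_left (v := fun s p ↦ A s p) (K := L)
      (s := fun _ ↦ univ) (fun s hs ↦ ?_)
      (fun s hs ↦ (hd s hs).continuousWithinAt) (fun s hs ↦ ?_) (fun _ _ ↦ mem_univ _)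
      continuousOn_const (fun s _ ↦ by simpa using hasDerivWithinAt_const s (Iic s) (0 : E))
      (fun _ _ ↦ mem_univ _) hv
    · exact ((A s).lipschitz.weaken (hL s (hsub (Ioc_subset_Icc_self hs)))).lipschitzOnWith
    · exact (hd s (Ioc_subset_Icc_self hs)).mono_of_mem_nhdsWithin (Icc_mem_nhdsLE_of_mem hs)
  simpa [hZ0] using key ⟨le_rfl, ht.1⟩

/-- The fundamental solution of the variational equation is the derivative of the flow with
respect to the initial value, relative to a compact convex set containing all solutions. -/
theorem exists_forall_norm_sub_fundamental_solution_le {K : Set E} (hK : Convex ℝ K)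
    (hc : IsCompact K) {f : E → E} {f' : E → E →L[ℝ] E}
    (hf : ∀ p ∈ K, HasFDerivWithinAt f (f' p) K p) (hf' : ContinuousOn f' K)
    {L a : ℝ} (hL0 : 0 < L) (hL : ∀ p ∈ K, ‖f' p‖ ≤ L)
    {γ : ℝ → E} (hγ : ∀ t ∈ Icc 0 a, HasDerivWithinAt γ (f (γ t)) (Icc 0 a) t)
    (hγK : ∀ t ∈ Icc 0 a, γ t ∈ K) {Z : ℝ → E →L[ℝ] E} (hZ0 : Z 0 = ContinuousLinearMap.id ℝ E)
    (hZ : ∀ t ∈ Icc 0 a, HasDerivWithinAt Z ((f' (γ t)).comp (Z t)) (Icc 0 a) t)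
    {ε : ℝ} (hε : 0 < ε) :
    ∃ δ > 0, ∀ η : ℝ → E, (∀ t ∈ Icc 0 a, HasDerivWithinAt η (f (η t)) (Icc 0 a) t) →
      (∀ t ∈ Icc 0 a, η t ∈ K) → ‖η 0 - γ 0‖ < δ →
      ∀ t ∈ Icc 0 a, ‖η t - γ t - Z t (η 0 - γ 0)‖ ≤ ε * ‖η 0 - γ 0‖ := by
  have hlip : LipschitzOnWith L.toNNReal f K :=
    hK.lipschitzOnWith_of_nnnorm_hasFDerivWithin_le hf fun p hp ↦ by
      rw [← NNReal.coe_le_coe, Real.coe_toNNReal _ hL0.le]; exact hL p hp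
  set c := Real.exp (L * a) with hcdef
  have hc0 : 0 < c := Real.exp_pos _
  -- One factor $c$ pays for the spreading of the two solutions (`hdist`), the other for the
  -- exponential in Gronwall's bound, and $L$ cancels the $1/L$ there. Starting within $\delta/c$
  -- keeps the solutions within $\delta$ of each other throughout.
  obtain ⟨δ, hδ, hmod⟩ := hK.exists_forall_norm_sub_sub_le_of_isCompact hc hf hf'
    (ε := ε * L / (c * c)) (by positivity)
  refine ⟨δ / c, by positivity, fun η hη hηK hδη t ht ↦ ?_⟩
  have ha : 0 ≤ a := ht.1.trans ht.2
  have right {u : ℝ → E} {u' : E} {s : ℝ} (hs : s ∈ Ico 0 a)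
      (h : HasDerivWithinAt u u' (Icc 0 a) s) : HasDerivWithinAt u u' (Ici s) s :=
    h.mono_of_mem_nhdsWithin (Icc_mem_nhdsGE_of_mem hs)
  have hdist (s : ℝ) (hs : s ∈ Icc 0 a) : ‖η s - γ s‖ ≤ ‖η 0 - γ 0‖ * c := by
    have := dist_le_of_trajectories_ODE_of_mem (v := fun _ ↦ f) (s := fun _ ↦ K)
      (K := L.toNNReal) (fun _ _ ↦ hlip) (fun s hs ↦ (hη s hs).continuousWithinAt)
      (fun s hs ↦ right hs (hη s (Ico_subset_Icc_self hs)))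
      (fun s hs ↦ hηK s (Ico_subset_Icc_self hs))
      (fun s hs ↦ (hγ s hs).continuousWithinAt)
      (fun s hs ↦ right hs (hγ s (Ico_subset_Icc_self hs)))
      (fun s hs ↦ hγK s (Ico_subset_Icc_self hs)) le_rfl s hs
    rw [dist_eq_norm, dist_eq_norm, Real.coe_toNNReal _ hL0.le] at this
    refine this.trans (mul_le_mul_of_nonneg_left (Real.exp_le_exp.2 ?_) (norm_nonneg _))
    have := hs.2
    gcongr
    simpa using this
  have hd (s : ℝ) (hs : s ∈ Icc 0 a) :
      HasDerivWithinAt (fun s ↦ η s - γ s - Z s (η 0 - γ 0))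
        (f (η s) - f (γ s) - f' (γ s) (Z s (η 0 - γ 0))) (Icc 0 a) s := by
    refine ((hη s hs).sub (hγ s hs)).sub ?_
    simpa using (hZ s hs).clm_apply (hasDerivWithinAt_const s _ (η 0 - γ 0))
  have hgr := norm_le_gronwallBound_of_norm_deriv_right_le (δ := 0) (K := L)
    (ε := ε * L / c * ‖η 0 - γ 0‖)
    (fun s hs ↦ (hd s hs).continuousWithinAt)
    (fun s hs ↦ right hs (hd s (Ico_subset_Icc_self hs))) (by simp [hZ0])
    (fun s hs ↦ ?_) t ht
  · refine hgr.trans ?_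
    rw [gronwallBound_of_K_ne_0 hL0.ne']
    have h1 : Real.exp (L * (t - 0)) - 1 ≤ c := by
      have : Real.exp (L * (t - 0)) ≤ c := Real.exp_le_exp.2 (by have := ht.2; gcongr; simpa)
      linarith
    calc 0 * Real.exp (L * (t - 0)) +
          ε * L / c * ‖η 0 - γ 0‖ / L * (Real.exp (L * (t - 0)) - 1)
        ≤ 0 + ε * L / c * ‖η 0 - γ 0‖ / L * c := by
          rw [zero_mul]; gcongr
      _ = ε * ‖η 0 - γ 0‖ := by field_simp; ring
  · have hs' := Ico_subset_Icc_self hs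
    have e1 : f (η s) - f (γ s) - f' (γ s) (Z s (η 0 - γ 0)) =
        f' (γ s) (η s - γ s - Z s (η 0 - γ 0)) +
          (f (η s) - f (γ s) - f' (γ s) (η s - γ s)) := by
      simp only [map_sub]; abel
    have hlt : ‖η s - γ s‖ < δ := (hdist s hs').trans_lt (by rwa [lt_div_iff₀ hc0] at hδη)
    calc _ ≤ ‖f' (γ s) (η s - γ s - Z s (η 0 - γ 0))‖ +
          ‖f (η s) - f (γ s) - f' (γ s) (η s - γ s)‖ := by rw [e1]; exact norm_add_le _ _
      _ ≤ L * ‖η s - γ s - Z s (η 0 - γ 0)‖ + ε * L / (c * c) * (‖η 0 - γ 0‖ * c) := by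
          refine add_le_add ((f' (γ s)).le_of_opNorm_le (hL _ (hγK s hs')) _)
            ((hmod _ (hγK s hs') _ (hηK s hs') hlt).trans ?_)
          exact mul_le_mul_of_nonneg_left (hdist s hs') (by positivity)
      _ = _ := by field_simp

end Euclidean

/-! ### Vector fields and functions on the tangent bundle, read in charts. -/

section Chart

variable {E : Type*} [NormedAddCommGroup E] [NormedSpace ℝ E]
  {H : Type*} [TopologicalSpace H] {I : ModelWithCorners ℝ E H}
  {M : Type*} [TopologicalSpace M] [ChartedSpace H M]

/-- The derivative at `x` of the extended chart around `x₀`. -/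
noncomputable def chartDeriv (x₀ x : M) : TangentSpace I x →L[ℝ] E :=
  mfderiv I 𝓘(ℝ, E) (extChartAt I x₀) x

/-- A vector field read in the extended chart around `x₀`. -/
noncomputable def chartField (G : (x : M) → TangentSpace I x) (x₀ : M) (p : E) : E :=
  chartDeriv x₀ ((extChartAt I x₀).symm p) (G ((extChartAt I x₀).symm p))

theorem chartField_extChartAt (G : (x : M) → TangentSpace I x) {x₀ x : M}
    (hx : x ∈ (extChartAt I x₀).source) :
    chartField G x₀ (extChartAt I x₀ x) = chartDeriv x₀ x (G x) := by
  rw [chartField, (extChartAt I x₀).left_inv hx]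

variable [IsManifold I ∞ M]

theorem isManifold_one_of_infty : IsManifold I 1 M := .of_le (n := ∞) (by norm_cast)

theorem hasMFDerivAt_chartDeriv {x₀ x : M} (hx : x ∈ (extChartAt I x₀).source) :
    HasMFDerivAt I 𝓘(ℝ, E) (extChartAt I x₀) x (chartDeriv x₀ x) := by
  have : IsManifold I 1 M := isManifold_one_of_infty
  exact (mdifferentiableAt_extChartAt (by simpa using hx)).hasMFDerivAt

theorem chartDeriv_bijective {x₀ x : M} (hx : x ∈ (extChartAt I x₀).source) :
    Function.Bijective (chartDeriv (I := I) x₀ x) := by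
  have : IsManifold I 1 M := isManifold_one_of_infty
  exact (isInvertible_mfderiv_extChartAt hx).bijective

theorem chartDeriv_eq_trivializationAt {x₀ : M} {v : TangentBundle I M}
    (hv : v.1 ∈ (extChartAt I x₀).source) :
    (trivializationAt E (TangentSpace I) x₀ v).2 = chartDeriv x₀ v.1 v.2 := by
  have : IsManifold I 1 M := isManifold_one_of_infty
  have h1 := TangentBundle.continuousLinearMapAt_trivializationAt (𝕜 := ℝ) (I := I) (x₀ := x₀)
    (x := v.1) (by simpa using hv)
  have h2 : (trivializationAt E (TangentSpace I) x₀).continuousLinearMapAt ℝ v.1 v.2 =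
    chartDeriv x₀ v.1 v.2 := congr($h1 v.2)
  rw [← h2, Trivialization.continuousLinearMapAt_apply,
    Trivialization.linearMapAt_apply, if_pos (by simpa using hv)]

theorem contDiffOn_chartField {G : (x : M) → TangentSpace I x}
    (hG : ContMDiff I I.tangent 1 (fun x ↦ (⟨x, G x⟩ : TangentBundle I M))) (x₀ : M) :
    ContDiffOn ℝ 1 (chartField G x₀) (extChartAt I x₀).target := by
  have : IsManifold I 1 M := isManifold_one_of_infty
  have : IsManifold I (1 + 1) M := .of_le (n := ∞) (by norm_cast)
  have : ContMDiffVectorBundle 1 E (TangentSpace I : M → Type _) I :=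
    TangentBundle.contMDiffVectorBundle
  rw [← contMDiffOn_iff_contDiffOn]
  have h1 : ContMDiffOn I 𝓘(ℝ, E) 1 (fun x ↦ chartDeriv x₀ x (G x)) (extChartAt I x₀).source := by
    intro x hx
    have h2 := ((Bundle.Trivialization.contMDiffAt_section_iff (IB := I) (n := 1)
      (e := trivializationAt E (TangentSpace I) x₀) (s := G) (by simpa using hx)).1 (hG x))
    refine (h2.congr_of_eventuallyEq ?_).contMDiffWithinAt
    filter_upwards [(isOpen_extChartAt_source x₀).mem_nhds hx] with y hy
    exact (chartDeriv_eq_trivializationAt (v := ⟨y, G y⟩) hy).symm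
  exact h1.comp (contMDiffOn_extChartAt_symm x₀) fun p hp ↦ (extChartAt I x₀).map_target hp

theorem IsMIntegralCurveOn.hasDerivWithinAt_extChartAt {G : (x : M) → TangentSpace I x}
    {γ : ℝ → M} {s : Set ℝ} (hγ : IsMIntegralCurveOn γ G s) {x₀ : M} {t : ℝ} (ht : t ∈ s)
    (hx : γ t ∈ (extChartAt I x₀).source) :
    HasDerivWithinAt (fun t ↦ extChartAt I x₀ (γ t)) (chartField G x₀ (extChartAt I x₀ (γ t)))
      s t := by
  have h := (hasMFDerivAt_chartDeriv hx).comp_hasMFDerivWithinAt t (hγ t ht)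
  have h2 : HasFDerivWithinAt (fun t ↦ extChartAt I x₀ (γ t))
      ((chartDeriv x₀ (γ t)).comp ((1 : ℝ →L[ℝ] ℝ).smulRight (G (γ t))) : ℝ →L[ℝ] E) s t :=
    hasMFDerivWithinAt_iff_hasFDerivWithinAt.1 h
  rw [chartField_extChartAt G hx]
  refine h2.hasDerivWithinAt.congr_deriv ?_
  change chartDeriv x₀ (γ t) ((1 : ℝ) • G (γ t)) = _
  rw [one_smul]

/-- A function on the tangent bundle read in the bundle chart over the extended chart around
`x₀`. -/
noncomputable def chartFun (N : TangentBundle I M → ℝ) (x₀ : M) (q : E × E) : ℝ :=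
  N ((extChartAt I.tangent (⟨x₀, 0⟩ : TangentBundle I M)).symm q)

theorem extChartAt_tangent_apply {x₀ : M} {v : TangentBundle I M}
    (hv : v.1 ∈ (extChartAt I x₀).source) :
    extChartAt I.tangent (⟨x₀, 0⟩ : TangentBundle I M) v =
      (extChartAt I x₀ v.1, chartDeriv x₀ v.1 v.2) := by
  rw [← chartDeriv_eq_trivializationAt hv]
  have : IsManifold I 1 M := isManifold_one_of_infty
  rw [FiberBundle.extChartAt]
  rfl

theorem mem_extChartAt_tangent_source {x₀ : M} {v : TangentBundle I M} :
    v ∈ (extChartAt I.tangent (⟨x₀, 0⟩ : TangentBundle I M)).source ↔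
      v.1 ∈ (extChartAt I x₀).source := by
  have : IsManifold I 1 M := isManifold_one_of_infty
  rw [extChartAt_source, extChartAt_source]
  exact TangentBundle.mem_chart_source_iff _ _

theorem extChartAt_tangent_target (x₀ : M) :
    (extChartAt I.tangent (⟨x₀, 0⟩ : TangentBundle I M)).target =
      (extChartAt I x₀).target ×ˢ univ := by
  have : IsManifold I 1 M := isManifold_one_of_infty
  rw [FiberBundle.extChartAt_target]
  congr 1
  refine inter_eq_left.2 fun p hp ↦ ?_
  simpa using (extChartAt I x₀).map_target hp

theorem chartFun_apply (N : TangentBundle I M → ℝ) {x₀ : M} {v : TangentBundle I M}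
    (hv : v.1 ∈ (extChartAt I x₀).source) :
    chartFun N x₀ (extChartAt I x₀ v.1, chartDeriv x₀ v.1 v.2) = N v := by
  rw [chartFun, ← extChartAt_tangent_apply hv, PartialEquiv.left_inv]
  exact mem_extChartAt_tangent_source.2 hv

theorem contDiffOn_chartFun {N : TangentBundle I M → ℝ} (hN : ContMDiff I.tangent 𝓘(ℝ) 1 N)
    (x₀ : M) : ContDiffOn ℝ 1 (chartFun N x₀) ((extChartAt I x₀).target ×ˢ univ) := by
  have : IsManifold I (1 + 1) M := .of_le (n := ∞) (by norm_cast)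
  have : ContMDiffVectorBundle 1 E (TangentSpace I : M → Type _) I :=
    TangentBundle.contMDiffVectorBundle
  have : IsManifold I 1 M := isManifold_one_of_infty
  rw [← extChartAt_tangent_target, ← contMDiffOn_iff_contDiffOn]
  exact hN.comp_contMDiffOn (contMDiffOn_extChartAt_symm _)

end Chart

/-! ### Flow boxes: short-time solutions in one chart. -/

section FlowBox

variable {E : Type*} [NormedAddCommGroup E] [NormedSpace ℝ E]
  {H : Type*} [TopologicalSpace H] {I : ModelWithCorners ℝ E H}
  {M : Type*} [TopologicalSpace M] [ChartedSpace H M]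

variable (I) in
/-- The closed ball of radius `r` in the extended chart around `x₀`. -/
def chartBall (x₀ : M) (r : ℝ) : Set E :=
  Metric.closedBall (extChartAt I x₀ x₀) r ∩ range I

/-- The derivative of a vector field read in the extended chart around `x₀`. -/
noncomputable def chartFieldDeriv (G : (x : M) → TangentSpace I x) (x₀ : M) (p : E) : E →L[ℝ] E :=
  fderivWithin ℝ (chartField G x₀) (extChartAt I x₀).target p

/-- A closed ball in a chart on which a vector field and its derivative are bounded. -/
structure IsFlowBox (G : (x : M) → TangentSpace I x) (x₀ : M) (r B L : ℝ) : Prop where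
  r_pos : 0 < r
  B_pos : 0 < B
  L_pos : 0 < L
  subset_target : chartBall I x₀ r ⊆ (extChartAt I x₀).target
  norm_field_le : ∀ p ∈ chartBall I x₀ r, ‖chartField G x₀ p‖ ≤ B
  norm_deriv_le : ∀ p ∈ chartBall I x₀ r, ‖chartFieldDeriv G x₀ p‖ ≤ L

theorem convex_chartBall (x₀ : M) (r : ℝ) : Convex ℝ (chartBall I x₀ r) :=
  (convex_closedBall _ _).inter I.convex_range

theorem isCompact_chartBall [FiniteDimensional ℝ E] (x₀ : M) (r : ℝ) :
    IsCompact (chartBall I x₀ r) := by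
  have : ProperSpace E := FiniteDimensional.proper ℝ E
  exact (isCompact_closedBall _ _).inter_right I.isClosed_range

/-- The points in the extended chart around `x₀` at distance less than `r` from the centre. -/
def boxNhd (I : ModelWithCorners ℝ E H) (x₀ : M) (r : ℝ) : Set M :=
  (extChartAt I x₀).source ∩ extChartAt I x₀ ⁻¹' Metric.ball (extChartAt I x₀ x₀) r

theorem isOpen_boxNhd (x₀ : M) (r : ℝ) : IsOpen (boxNhd I x₀ r) :=
  (continuousOn_extChartAt x₀).isOpen_inter_preimage (isOpen_extChartAt_source x₀)
    Metric.isOpen_ball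

theorem mem_boxNhd_self (x₀ : M) {r : ℝ} (hr : 0 < r) : x₀ ∈ boxNhd I x₀ r :=
  ⟨mem_extChartAt_source x₀, Metric.mem_ball_self hr⟩

theorem extChartAt_mem_range {x₀ x : M} (hx : x ∈ (extChartAt I x₀).source) :
    extChartAt I x₀ x ∈ range I :=
  extChartAt_target_subset_range x₀ ((extChartAt I x₀).map_source hx)

variable [IsManifold I ∞ M] {G : (x : M) → TangentSpace I x}

theorem hasFDerivWithinAt_chartField
    (hG : ContMDiff I I.tangent 1 (fun x ↦ (⟨x, G x⟩ : TangentBundle I M))) {x₀ : M} {p : E}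
    (hp : p ∈ (extChartAt I x₀).target) :
    HasFDerivWithinAt (chartField G x₀) (chartFieldDeriv G x₀ p) (extChartAt I x₀).target p :=
  ((contDiffOn_chartField hG x₀).differentiableOn one_ne_zero p hp).hasFDerivWithinAt

theorem continuousOn_chartFieldDeriv
    (hG : ContMDiff I I.tangent 1 (fun x ↦ (⟨x, G x⟩ : TangentBundle I M))) (x₀ : M) :
    ContinuousOn (chartFieldDeriv G x₀) (extChartAt I x₀).target :=
  (contDiffOn_chartField hG x₀).continuousOn_fderivWithin (uniqueDiffOn_extChartAt_target x₀)
    le_rfl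

theorem exists_isFlowBox [FiniteDimensional ℝ E]
    (hG : ContMDiff I I.tangent 1 (fun x ↦ (⟨x, G x⟩ : TangentBundle I M))) (x₀ : M) :
    ∃ r B L, IsFlowBox G x₀ r B L := by
  obtain ⟨r, hr, hsub⟩ := (nhdsWithin_hasBasis Metric.nhds_basis_closedBall _).mem_iff.1
    (extChartAt_target_mem_nhdsWithin (I := I) x₀)
  have hc := isCompact_chartBall (I := I) x₀ r
  obtain ⟨B, hB⟩ := hc.exists_bound_of_continuousOn
    ((contDiffOn_chartField hG x₀).continuousOn.mono hsub)
  obtain ⟨L, hL⟩ := hc.exists_bound_of_continuousOn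
    ((continuousOn_chartFieldDeriv hG x₀).mono hsub)
  exact ⟨r, max B 1, max L 1, hr, by positivity, by positivity, hsub,
    fun p hp ↦ (hB p hp).trans (le_max_left _ _), fun p hp ↦ (hL p hp).trans (le_max_left _ _)⟩

/-- An integral curve starting near the centre of a flow box stays in the box for a short time. -/
theorem IsFlowBox.mem_of_isMIntegralCurveOn [FiniteDimensional ℝ E] [T2Space M]
    {x₀ : M} {r B L a : ℝ} (hbox : IsFlowBox G x₀ r B L) {γ : ℝ → M}
    (hγ : IsMIntegralCurveOn γ G (Icc 0 a)) (ha : B * a ≤ r / 4)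
    (h0 : γ 0 ∈ boxNhd I x₀ (r / 2)) {t : ℝ} (ht : t ∈ Icc 0 a) :
    γ t ∈ (extChartAt I x₀).source ∧ extChartAt I x₀ (γ t) ∈ chartBall I x₀ r := by
  set e := extChartAt I x₀ with he
  have hB := hbox.B_pos
  have hr := hbox.r_pos
  -- A compact set in a Hausdorff space is closed, so a limit of curve points lying in the box is
  -- still in the chart domain. This is what makes `S` closed below.
  have hV : IsClosed (e.symm '' chartBall I x₀ r) :=
    ((isCompact_chartBall x₀ r).image_of_continuousOn
      ((continuousOn_extChartAt_symm x₀).mono hbox.subset_target)).isClosed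
  have hVmem {x : M} : x ∈ e.symm '' chartBall I x₀ r ↔
      x ∈ e.source ∧ e x ∈ chartBall I x₀ r := by
    constructor
    · rintro ⟨p, hp, rfl⟩
      exact ⟨e.map_target (hbox.subset_target hp), by
        rwa [e.right_inv (hbox.subset_target hp)]⟩
    · exact fun h ↦ ⟨e x, h.2, e.left_inv h.1⟩
  have hbound {s : ℝ} (hs : s ∈ Icc 0 a) : r / 2 + B * s ≤ 3 / 4 * r := by
    have : B * s ≤ B * a := by gcongr; exact hs.2
    linarith
  -- Continuous induction on a bound growing with time: $r/2+Bt$ never exceeds $3r/4$, so at any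
  -- time of `S` there is room to continue inside the ball of radius $r$, where the speed bound $B$
  -- reproduces the estimate.
  set S : Set ℝ := {t | γ t ∈ e.source ∧ dist (e (γ t)) (e x₀) ≤ r / 2 + B * t} with hS
  suffices h : Icc 0 a ⊆ S by
    refine ⟨(h ht).1, ?_, extChartAt_mem_range (h ht).1⟩
    have := hbound ht
    exact Metric.mem_closedBall.2 ((h ht).2.trans (by linarith))
  refine IsClosed.Icc_subset_of_forall_exists_gt ?_ ?_ ?_
  · set A := Icc 0 a ∩ γ ⁻¹' (e.symm '' chartBall I x₀ r) with hA
    have hAc : IsClosed A := hγ.continuousOn.preimage_isClosed_of_isClosed isClosed_Icc hV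
    have hcont : ContinuousOn (fun t ↦ dist (e (γ t)) (e x₀) - B * t) A := by
      have : ContinuousOn (fun t ↦ e (γ t)) A :=
        (continuousOn_extChartAt x₀).comp (hγ.continuousOn.mono inter_subset_left)
          fun s hs ↦ (hVmem.1 hs.2).1
      exact (continuous_id.dist continuous_const).comp_continuousOn this |>.sub (by fun_prop)
    convert hcont.preimage_isClosed_of_isClosed hAc (isClosed_Iic (a := r / 2)) using 1
    ext s
    simp only [hS, hA, mem_inter_iff, mem_ofPred_eq, mem_preimage, mem_Iic, hVmem]
    constructor
    · rintro ⟨⟨h1, h2⟩, h3⟩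
      have := hbound h3
      exact ⟨⟨h3, h1, Metric.mem_closedBall.2 (by linarith), extChartAt_mem_range h1⟩,
        by linarith⟩
    · rintro ⟨⟨h1, h2, -⟩, h3⟩
      exact ⟨⟨h2, by linarith⟩, h1⟩
  · exact ⟨h0.1, by rw [mul_zero, add_zero]; exact (Metric.mem_ball.1 h0.2).le⟩
  · rintro x ⟨⟨hx1, hx2⟩, hx3⟩ y hy
    have hxa := Ico_subset_Icc_self hx3
    have hO : boxNhd I x₀ r ∈ 𝓝 (γ x) := by
      refine (isOpen_boxNhd x₀ r).mem_nhds ⟨hx1, Metric.mem_ball.2 ?_⟩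
      have := hbound hxa
      exact hx2.trans_lt (by linarith)
    have hev : ∀ᶠ z in 𝓝[≥] x, γ z ∈ boxNhd I x₀ r := by
      have := (hγ.continuousOn x hxa).eventually hO
      exact this.filter_mono (nhdsWithin_le_of_mem (Icc_mem_nhdsGE_of_mem hx3))
    obtain ⟨u, hu, hsub⟩ := (mem_nhdsGE_iff_exists_Icc_subset).1 hev
    set z := min u (min y a) with hz
    have hxz : x < z := lt_min hu (lt_min hy hx3.2)
    have hzsub : Icc x z ⊆ Icc 0 a := Icc_subset_Icc hxa.1 (by simp [hz])
    have hsrc {w : ℝ} (hw : w ∈ Icc x z) : γ w ∈ boxNhd I x₀ r :=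
      hsub ⟨hw.1, hw.2.trans (min_le_left _ _)⟩
    have hd := norm_image_sub_le_of_norm_deriv_le_segment' (f := fun t ↦ e (γ t)) (C := B)
      (fun w hw ↦ (hγ.mono hzsub).hasDerivWithinAt_extChartAt hw (hsrc hw).1)
      (fun w hw ↦ hbox.norm_field_le _
        ⟨Metric.ball_subset_closedBall (hsrc (Ico_subset_Icc_self hw)).2,
          extChartAt_mem_range (hsrc (Ico_subset_Icc_self hw)).1⟩) z ⟨hxz.le, le_rfl⟩
    refine ⟨z, ⟨(hsrc ⟨hxz.le, le_rfl⟩).1, ?_⟩, hxz, (min_le_right _ _).trans (min_le_left _ _)⟩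
    have h1 := dist_triangle (e (γ z)) (e (γ x)) (e x₀)
    rw [dist_eq_norm (e (γ z)) (e (γ x))] at h1
    linarith

/-- Two integral curves starting at the same point of a flow box agree for a short time. -/
theorem IsFlowBox.eqOn_of_isMIntegralCurveOn [FiniteDimensional ℝ E] [T2Space M]
    (hG : ContMDiff I I.tangent 1 (fun x ↦ (⟨x, G x⟩ : TangentBundle I M)))
    {x₀ : M} {r B L a : ℝ} (hbox : IsFlowBox G x₀ r B L) {γ γ' : ℝ → M}
    (hγ : IsMIntegralCurveOn γ G (Icc 0 a)) (hγ' : IsMIntegralCurveOn γ' G (Icc 0 a))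
    (ha : B * a ≤ r / 4) (h0 : γ 0 ∈ boxNhd I x₀ (r / 2)) (h : γ 0 = γ' 0) :
    EqOn γ γ' (Icc 0 a) := by
  have hm {t : ℝ} (ht : t ∈ Icc 0 a) := hbox.mem_of_isMIntegralCurveOn hγ ha h0 ht
  have hm' {t : ℝ} (ht : t ∈ Icc 0 a) := hbox.mem_of_isMIntegralCurveOn hγ' ha (h ▸ h0) ht
  have hlip : LipschitzOnWith L.toNNReal (chartField G x₀) (chartBall I x₀ r) :=
    (convex_chartBall x₀ r).lipschitzOnWith_of_nnnorm_hasFDerivWithin_le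
      (fun p hp ↦ (hasFDerivWithinAt_chartField hG (hbox.subset_target hp)).mono
        hbox.subset_target) fun p hp ↦ by
      rw [← NNReal.coe_le_coe, Real.coe_toNNReal _ hbox.L_pos.le]; exact hbox.norm_deriv_le p hp
  have key : EqOn (fun t ↦ extChartAt I x₀ (γ t)) (fun t ↦ extChartAt I x₀ (γ' t)) (Icc 0 a) :=
    ODE_solution_unique_of_mem_Icc_right (v := fun _ ↦ chartField G x₀)
      (s := fun _ ↦ chartBall I x₀ r) (fun _ _ ↦ hlip)
      (fun s hs ↦ (hγ.hasDerivWithinAt_extChartAt hs (hm hs).1).continuousWithinAt)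
      (fun s hs ↦ (hγ.hasDerivWithinAt_extChartAt (Ico_subset_Icc_self hs)
        (hm (Ico_subset_Icc_self hs)).1).mono_of_mem_nhdsWithin (Icc_mem_nhdsGE_of_mem hs))
      (fun s hs ↦ (hm (Ico_subset_Icc_self hs)).2)
      (fun s hs ↦ (hγ'.hasDerivWithinAt_extChartAt hs (hm' hs).1).continuousWithinAt)
      (fun s hs ↦ (hγ'.hasDerivWithinAt_extChartAt (Ico_subset_Icc_self hs)
        (hm' (Ico_subset_Icc_self hs)).1).mono_of_mem_nhdsWithin (Icc_mem_nhdsGE_of_mem hs))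
      (fun s hs ↦ (hm' (Ico_subset_Icc_self hs)).2) (by simp [h])
  exact fun t ht ↦ (extChartAt I x₀).injOn (hm ht).1 (hm' ht).1 (key ht)

/-- The derivative of a short-time flow with respect to the point, read in a flow box, is the
fundamental solution of the variational equation. -/
theorem IsFlowBox.exists_fundamental_solution [FiniteDimensional ℝ E] [T2Space M]
    (hG : ContMDiff I I.tangent 1 (fun x ↦ (⟨x, G x⟩ : TangentBundle I M)))
    {x₀ : M} {r B L a : ℝ} (hbox : IsFlowBox G x₀ r B L) {φ : ℝ → M → M}
    (hφ0 : ∀ x, φ 0 x = x) (hφ : ∀ x, IsMIntegralCurveOn (fun t ↦ φ t x) G (Icc 0 a))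
    (ha0 : 0 ≤ a) (ha : B * a ≤ r / 4) (haL : 2 * L * a ≤ 1)
    {x : M} (hx : x ∈ boxNhd I x₀ (r / 2)) :
    ∃ Z : ℝ → E →L[ℝ] E, Z 0 = ContinuousLinearMap.id ℝ E ∧
      (∀ t ∈ Icc 0 a, HasDerivWithinAt Z
        ((chartFieldDeriv G x₀ (extChartAt I x₀ (φ t x))).comp (Z t)) (Icc 0 a) t) ∧
      ∀ t ∈ Icc 0 a, Function.Injective (Z t) ∧ MDifferentiableAt I I (φ t) x ∧
        ∀ v : TangentSpace I x,
          chartDeriv x₀ (φ t x) (mfderiv I I (φ t) x v) = Z t (chartDeriv x₀ x v) := by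
  have : IsManifold I 1 M := isManifold_one_of_infty
  have : CompleteSpace E := FiniteDimensional.complete ℝ E
  set e := extChartAt I x₀ with he
  have hm {y : M} (hy : y ∈ boxNhd I x₀ (r / 2)) {t : ℝ} (ht : t ∈ Icc 0 a) :=
    hbox.mem_of_isMIntegralCurveOn (hφ y) ha (by simpa [hφ0] using hy) ht
  have hsol {y : M} (hy : y ∈ boxNhd I x₀ (r / 2)) {t : ℝ} (ht : t ∈ Icc 0 a) :=
    (hφ y).hasDerivWithinAt_extChartAt ht (hm hy ht).1
  have hf (p : E) (hp : p ∈ chartBall I x₀ r) :=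
    (hasFDerivWithinAt_chartField hG (hbox.subset_target hp)).mono hbox.subset_target
  have hf' := (continuousOn_chartFieldDeriv hG x₀).mono hbox.subset_target
  have hAc : ContinuousOn (fun t ↦ chartFieldDeriv G x₀ (e (φ t x))) (Icc 0 a) :=
    hf'.comp (fun t ht ↦ (hsol hx ht).continuousWithinAt) fun t ht ↦ (hm hx ht).2
  have hAL (t : ℝ) (ht : t ∈ Icc 0 a) : ‖chartFieldDeriv G x₀ (e (φ t x))‖ ≤ L :=
    hbox.norm_deriv_le _ (hm hx ht).2
  obtain ⟨Z, hZ0, hZ⟩ := _root_.exists_fundamental_solution ha0 hAc hAL haL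
  refine ⟨Z, hZ0, hZ, fun t ht ↦ ⟨fundamental_solution_injective hAL hZ0 hZ ht, ?_⟩⟩
  set u : E → E := fun p ↦ e (φ t (e.symm p)) with hu
  -- At a boundary point the chart image is only a neighbourhood within `range I`, so the derivative
  -- is taken relative to it. On the manifold it becomes an unrestricted derivative again.
  have hud : HasFDerivWithinAt u (Z t) (range I) (e x) := by
    rw [hasFDerivWithinAt_iff_isLittleO, Asymptotics.isLittleO_iff]
    intro ε hε
    obtain ⟨δ, hδ, h⟩ := exists_forall_norm_sub_fundamental_solution_le (convex_chartBall x₀ r)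
      (isCompact_chartBall x₀ r) hf hf' hbox.L_pos hbox.norm_deriv_le
      (fun t ht ↦ hsol hx ht) (fun t ht ↦ (hm hx ht).2) hZ0 hZ hε
    have h1 : ∀ᶠ p in 𝓝[range I] (e x), p ∈ e.target :=
      extChartAt_target_mem_nhdsWithin' hx.1
    have h2 : ∀ᶠ p in 𝓝[range I] (e x), p ∈ Metric.ball (e x) δ :=
      mem_nhdsWithin_of_mem_nhds (Metric.ball_mem_nhds _ hδ)
    have h3 : ∀ᶠ p in 𝓝[range I] (e x), p ∈ Metric.ball (e x₀) (r / 2) :=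
      mem_nhdsWithin_of_mem_nhds (Metric.isOpen_ball.mem_nhds hx.2)
    filter_upwards [h1, h2, h3] with p hp1 hp2 hp3
    have hy : e.symm p ∈ boxNhd I x₀ (r / 2) :=
      ⟨e.map_target hp1, by rwa [mem_preimage, e.right_inv hp1]⟩
    have := h (fun s ↦ e (φ s (e.symm p))) (fun s hs ↦ hsol hy hs) (fun s hs ↦ (hm hy hs).2)
      (by simp only [hφ0, e.right_inv hp1]; rwa [← dist_eq_norm]) t ht
    simp only [hφ0, e.right_inv hp1] at this
    simp only [hu, e.left_inv hx.1]
    exact this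
  have hue : HasMFDerivAt I 𝓘(ℝ, E) (u ∘ e) x ((Z t).comp (chartDeriv x₀ x)) := by
    refine HasMFDerivWithinAt.hasMFDerivAt (s := e.source) ?_
      ((isOpen_extChartAt_source x₀).mem_nhds hx.1)
    exact HasMFDerivWithinAt.comp x (hasMFDerivWithinAt_iff_hasFDerivWithinAt.2 hud)
      (hasMFDerivAt_chartDeriv hx.1).hasMFDerivWithinAt
      fun y hy ↦ extChartAt_mem_range hy
  have heφ : HasMFDerivAt I 𝓘(ℝ, E) (e ∘ φ t) x ((Z t).comp (chartDeriv x₀ x)) := by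
    refine hue.congr_of_eventuallyEq ?_
    filter_upwards [(isOpen_extChartAt_source x₀).mem_nhds hx.1] with y hy
    simp [hu, e.left_inv hy]
  have hW : boxNhd I x₀ (r / 2) ∈ 𝓝 x := (isOpen_boxNhd x₀ _).mem_nhds hx
  have hdiff : MDifferentiableAt I I (φ t) x := by
    have h1 : MDifferentiableWithinAt 𝓘(ℝ, E) I e.symm (range I) ((e ∘ φ t) x) :=
      mdifferentiableWithinAt_extChartAt_symm (e.map_source (hm hx ht).1)
    have h2 := h1.comp x (heφ.mdifferentiableAt.mdifferentiableWithinAt (s := boxNhd I x₀ (r / 2)))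
      fun y hy ↦ extChartAt_mem_range (hm hy ht).1
    refine (h2.mdifferentiableAt hW).congr_of_eventuallyEq ?_
    filter_upwards [hW] with y hy
    exact (e.left_inv (hm hy ht).1).symm
  refine ⟨hdiff, fun v ↦ ?_⟩
  have h1 := (hasMFDerivAt_chartDeriv (hm hx ht).1).comp x hdiff.hasMFDerivAt
  exact congr($(hasMFDerivAt_unique h1 heφ) v)

end FlowBox

/-! ### Partial flows: from a forward semigroup to times of either sign. -/

section PartialFlow

/-- A semigroup of injective maps `A s`, `0 ≤ s`, of the invariant set `S`, extended to negative
times by the inverse maps; `J v` is the set of times `t` at which `A t v` is defined. -/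
structure IsPartialFlow {X : Type*} (S : Set X) (J : X → Set ℝ) (A : ℝ → X → X) : Prop where
  mem_of_nonneg : ∀ v ∈ S, ∀ t, 0 ≤ t → t ∈ J v
  mapsTo : ∀ v ∈ S, ∀ t, 0 ≤ t → A t v ∈ S
  map_zero : ∀ v ∈ S, A 0 v = v
  map_add : ∀ v ∈ S, ∀ s t, 0 ≤ s → 0 ≤ t → A (s + t) v = A s (A t v)
  neg_mem : ∀ v ∈ S, ∀ s, 0 ≤ s → -s ∈ J (A s v)
  map_neg : ∀ v ∈ S, ∀ s, 0 ≤ s → A (-s) (A s v) = v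
  exists_of_neg_mem : ∀ v ∈ S, ∀ s, 0 ≤ s → -s ∈ J v → ∃ w ∈ S, A s w = v

namespace IsPartialFlow

variable {X : Type*} {S : Set X} {J : X → Set ℝ} {A : ℝ → X → X} (h : IsPartialFlow S J A)
include h

theorem eq_of_map_eq {v w : X} (hv : v ∈ S) (hw : w ∈ S) {s : ℝ} (hs : 0 ≤ s)
    (hvw : A s v = A s w) : v = w := by
  rw [← h.map_neg v hv s hs, hvw, h.map_neg w hw s hs]

/-- Two points whose forward orbits meet lie on one orbit, and the time difference is determined:
cancel the smaller of $a$ and $b$ by injectivity. With its converse `exists_sub_eq`, this reduces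
every law for signed times to the forward semigroup. -/
theorem sub_mem_and_map_sub {v w : X} (hv : v ∈ S) (hw : w ∈ S) {a b : ℝ} (ha : 0 ≤ a)
    (hb : 0 ≤ b) (hvw : A a v = A b w) : a - b ∈ J v ∧ A (a - b) v = w := by
  rcases le_total b a with hab | hab
  · have h1 : 0 ≤ a - b := sub_nonneg.2 hab
    refine ⟨h.mem_of_nonneg v hv _ h1, h.eq_of_map_eq (h.mapsTo v hv _ h1) hw hb ?_⟩
    rw [← h.map_add v hv b _ hb h1, ← hvw, add_sub_cancel]
  · have h1 : 0 ≤ b - a := sub_nonneg.2 hab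
    have h2 : v = A (b - a) w := by
      refine h.eq_of_map_eq hv (h.mapsTo w hw _ h1) ha ?_
      rw [← h.map_add w hw a _ ha h1, hvw, add_sub_cancel]
    rw [h2, ← neg_sub b a]
    exact ⟨h.neg_mem w hw _ h1, h.map_neg w hw _ h1⟩

theorem exists_sub_eq {v : X} (hv : v ∈ S) {t : ℝ} (ht : t ∈ J v) :
    A t v ∈ S ∧ ∃ a b, 0 ≤ a ∧ 0 ≤ b ∧ a - b = t ∧ A a v = A b (A t v) := by
  rcases le_total 0 t with h0 | h0
  · have := h.mapsTo v hv t h0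
    exact ⟨this, t, 0, h0, le_rfl, sub_zero t, (h.map_zero _ this).symm⟩
  · have h1 : 0 ≤ -t := neg_nonneg.2 h0
    obtain ⟨w, hw, rfl⟩ := h.exists_of_neg_mem v hv (-t) h1 (by simpa using ht)
    have h2 := h.map_neg w hw (-t) h1
    rw [neg_neg] at h2
    rw [h2]
    exact ⟨hw, 0, -t, le_rfl, h1, by ring, h.map_zero _ hv⟩

theorem map_mem {v : X} (hv : v ∈ S) {t : ℝ} (ht : t ∈ J v) : A t v ∈ S :=
  (h.exists_sub_eq hv ht).1

theorem add_mem_and_map_add {v : X} (hv : v ∈ S) {t u : ℝ} (ht : t ∈ J v) (hu : u ∈ J (A t v)) :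
    t + u ∈ J v ∧ A (t + u) v = A u (A t v) := by
  obtain ⟨h1, a, b, ha, hb, rfl, hab⟩ := h.exists_sub_eq hv ht
  obtain ⟨h2, c, d, hc, hd, rfl, hcd⟩ := h.exists_sub_eq h1 hu
  have : A (c + a) v = A (b + d) (A (c - d) (A (a - b) v)) := by
    rw [h.map_add _ hv c a hc ha, hab, ← h.map_add _ h1 c b hc hb, add_comm c b,
      h.map_add _ h1 b c hb hc, hcd, ← h.map_add _ h2 b d hb hd]
  have := h.sub_mem_and_map_sub hv h2 (add_nonneg hc ha) (add_nonneg hb hd) this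
  rwa [show c + a - (b + d) = a - b + (c - d) by ring] at this

theorem neg_mem_and_map_neg {v : X} (hv : v ∈ S) {t : ℝ} (ht : t ∈ J v) :
    -t ∈ J (A t v) ∧ A (-t) (A t v) = v := by
  obtain ⟨h1, a, b, ha, hb, rfl, hab⟩ := h.exists_sub_eq hv ht
  have := h.sub_mem_and_map_sub h1 hv hb ha hab.symm
  rwa [← neg_sub a b] at this

theorem mem_map_iff {v : X} (hv : v ∈ S) {t u : ℝ} (ht : t ∈ J v) :
    u ∈ J (A t v) ↔ t + u ∈ J v := by
  refine ⟨fun hu ↦ (h.add_mem_and_map_add hv ht hu).1, fun hu ↦ ?_⟩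
  obtain ⟨h1, h2⟩ := h.neg_mem_and_map_neg hv ht
  have := (h.add_mem_and_map_add (h.map_mem hv ht) h1 (u := t + u) (by rwa [h2])).1
  rwa [neg_add_cancel_left] at this

theorem bijOn (t : ℝ) : BijOn (A t) {v | v ∈ S ∧ t ∈ J v} {w | w ∈ S ∧ -t ∈ J w} := by
  refine ⟨fun v hv ↦ ⟨h.map_mem hv.1 hv.2, (h.neg_mem_and_map_neg hv.1 hv.2).1⟩,
    fun v hv w hw hvw ↦ ?_, fun w hw ↦ ?_⟩
  · rw [← (h.neg_mem_and_map_neg hv.1 hv.2).2, hvw, (h.neg_mem_and_map_neg hw.1 hw.2).2]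
  · have := h.neg_mem_and_map_neg hw.1 hw.2
    rw [neg_neg] at this
    exact ⟨A (-t) w, ⟨h.map_mem hw.1 hw.2, this.1⟩, this.2⟩

theorem inverseOn_eq {w : X} (hw : w ∈ S) {t : ℝ} (ht : -t ∈ J w) :
    inverseOn (A t) {v | v ∈ S ∧ t ∈ J v} w = A (-t) w := by
  have h1 := h.neg_mem_and_map_neg hw ht
  rw [neg_neg] at h1
  have hmem : A (-t) w ∈ {v | v ∈ S ∧ t ∈ J v} := ⟨h.map_mem hw ht, h1.1⟩
  have hex : ∃ a ∈ {v | v ∈ S ∧ t ∈ J v}, A t a = w := ⟨_, hmem, h1.2⟩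
  have : Nonempty X := ⟨w⟩
  exact (h.bijOn t).injOn (Function.invFunOn_mem hex) hmem
    ((Function.invFunOn_eq hex).trans h1.2.symm)

theorem uIcc_subset {v : X} (hv : v ∈ S) {t : ℝ} (ht : t ∈ J v) : uIcc 0 t ⊆ J v := by
  intro s hs
  rcases le_total 0 t with h0 | h0
  · rw [uIcc_of_le h0] at hs
    exact h.mem_of_nonneg v hv s hs.1
  · rw [uIcc_of_ge h0] at hs
    -- Restart from the earliest point $w=A_t v$: times in $[t,0]$ for $v$ are times at least $0$
    -- for $w$, hence admissible.
    have hw := h.map_mem hv ht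
    have h2 := h.neg_mem_and_map_neg hv ht
    have h3 := (h.mem_map_iff hw h2.1 (u := s)).2
      (h.mem_of_nonneg _ hw _ (by linarith [hs.1]))
    rwa [h2.2] at h3

end IsPartialFlow

end PartialFlow

/-! ### Uniqueness of integral curves and the flow on a compact manifold. -/

section Flow

variable {E : Type*} [NormedAddCommGroup E] [NormedSpace ℝ E] [FiniteDimensional ℝ E]
  {H : Type*} [TopologicalSpace H] {I : ModelWithCorners ℝ E H}
  {M : Type*} [TopologicalSpace M] [ChartedSpace H M] [IsManifold I ∞ M]
  [T2Space M] [CompactSpace M] {G : (x : M) → TangentSpace I x}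
  (hG : ContMDiff I I.tangent 1 (fun x ↦ (⟨x, G x⟩ : TangentBundle I M)))

include hG

omit [T2Space M] in
/-- On a compact manifold, flow boxes have a uniform lifetime. -/
theorem exists_uniform_isFlowBox :
    ∃ τ > 0, ∀ x : M, ∃ x₀ r B L, IsFlowBox G x₀ r B L ∧ x ∈ boxNhd I x₀ (r / 2) ∧
      B * τ ≤ r / 4 ∧ 2 * L * τ ≤ 1 := by
  suffices h : ∃ τ > 0, ∀ x ∈ (univ : Set M), ∃ x₀ r B L, IsFlowBox G x₀ r B L ∧
      x ∈ boxNhd I x₀ (r / 2) ∧ B * τ ≤ r / 4 ∧ 2 * L * τ ≤ 1 by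
    simpa using h
  have mono {τ τ' : ℝ} (hτ : τ' ≤ τ) {x : M}
      (h : ∃ x₀ r B L, IsFlowBox G x₀ r B L ∧
        x ∈ boxNhd I x₀ (r / 2) ∧ B * τ ≤ r / 4 ∧ 2 * L * τ ≤ 1) :
      ∃ x₀ r B L, IsFlowBox G x₀ r B L ∧
        x ∈ boxNhd I x₀ (r / 2) ∧ B * τ' ≤ r / 4 ∧ 2 * L * τ' ≤ 1 := by
    obtain ⟨x₀, r, B, L, h1, h2, h3, h4⟩ := h
    have := h1.B_pos
    have := h1.L_pos
    exact ⟨x₀, r, B, L, h1, h2, le_trans (by gcongr) h3, le_trans (by gcongr) h4⟩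
  refine isCompact_univ.induction_on (p := fun s : Set M ↦ ∃ τ > 0, ∀ x ∈ s,
    ∃ x₀ r B L, IsFlowBox G x₀ r B L ∧ x ∈ boxNhd I x₀ (r / 2) ∧ B * τ ≤ r / 4 ∧
      2 * L * τ ≤ 1) ⟨1, one_pos, by simp⟩ ?_ ?_ ?_
  · rintro s t hst ⟨τ, hτ, h⟩
    exact ⟨τ, hτ, fun x hx ↦ h x (hst hx)⟩
  · rintro s t ⟨τ, hτ, h⟩ ⟨τ', hτ', h'⟩
    refine ⟨min τ τ', lt_min hτ hτ', ?_⟩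
    rintro x (hx | hx)
    exacts [mono (min_le_left _ _) (h x hx), mono (min_le_right _ _) (h' x hx)]
  · intro x₀ _
    obtain ⟨r, B, L, h⟩ := exists_isFlowBox hG x₀
    have hr := h.r_pos
    have hB := h.B_pos
    have hL := h.L_pos
    refine ⟨boxNhd I x₀ (r / 2), mem_nhdsWithin_of_mem_nhds
      ((isOpen_boxNhd x₀ _).mem_nhds (mem_boxNhd_self x₀ (half_pos hr))),
      min (r / (4 * B)) (1 / (2 * L)), lt_min (by positivity) (by positivity),
      fun x hx ↦ ⟨x₀, r, B, L, h, hx, ?_, ?_⟩⟩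
    · calc B * _ ≤ B * (r / (4 * B)) := by gcongr; exact min_le_left _ _
        _ = r / 4 := by field_simp
    · calc 2 * L * _ ≤ 2 * L * (1 / (2 * L)) := by gcongr; exact min_le_right _ _
        _ = 1 := by field_simp

/-- Integral curves of a `C^1` vector field on a compact manifold, possibly with boundary, are
determined by their initial value. -/
theorem IsMIntegralCurveOn.eq_of_eq_zero {γ γ' : ℝ → M} {a : ℝ}
    (hγ : IsMIntegralCurveOn γ G (Icc 0 a)) (hγ' : IsMIntegralCurveOn γ' G (Icc 0 a))
    (h : γ 0 = γ' 0) (ha : 0 ≤ a) : γ a = γ' a := by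
  obtain ⟨τ, hτ, hbox⟩ := exists_uniform_isFlowBox hG
  obtain ⟨n, hn⟩ := exists_nat_ge (a / τ)
  rw [div_le_iff₀ hτ] at hn
  induction n generalizing γ γ' a with
  -- Induction on the number of steps of length $\tau$: the curves agree up to time $\tau$ inside
  -- one box, and the curves shifted by $\tau$ have remaining length $a-\tau$.
  | zero =>
    have : a = 0 := le_antisymm (by simpa using hn) ha
    rw [this, h]
  | succ n ih =>
    obtain ⟨x₀, r, B, L, h1, h2, h3, -⟩ := hbox (γ 0)
    have hmin : EqOn γ γ' (Icc 0 (min a τ)) := by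
      have hsub : Icc 0 (min a τ) ⊆ Icc 0 a := Icc_subset_Icc_right (min_le_left _ _)
      refine h1.eqOn_of_isMIntegralCurveOn hG (hγ.mono hsub) (hγ'.mono hsub) ?_ h2 h
      have := h1.B_pos
      exact le_trans (by gcongr; exact min_le_right _ _) h3
    rcases le_total a τ with haτ | haτ
    · exact hmin ⟨ha, by simp [haτ]⟩
    · have hsub : Icc 0 (a - τ) ⊆ {t | t + τ ∈ Icc 0 a} := fun t ht ↦
        ⟨by linarith [ht.1], by linarith [ht.2]⟩
      have := ih ((hγ.comp_add τ).mono hsub) ((hγ'.comp_add τ).mono hsub)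
        (by simpa using hmin ⟨hτ.le, by simp [haτ]⟩) (by linarith)
        (by push_cast at hn; linarith)
      simpa using this

/-- Reverse time: $t\mapsto\gamma(a-t)$ is an integral curve of $-G$, so forward uniqueness applies
to it. This gives injectivity of $\phi_s$. -/
theorem IsMIntegralCurveOn.eq_of_eq_right {γ γ' : ℝ → M} {a : ℝ}
    (hγ : IsMIntegralCurveOn γ G (Icc 0 a)) (hγ' : IsMIntegralCurveOn γ' G (Icc 0 a))
    (h : γ a = γ' a) (ha : 0 ≤ a) : γ 0 = γ' 0 := by
  have hG' : ContMDiff I I.tangent 1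
      (fun x ↦ (⟨x, ((-1 : ℝ) • G) x⟩ : TangentBundle I M)) := by
    have : IsManifold I 1 M := isManifold_one_of_infty
    have : IsManifold I (1 + 1) M := .of_le (n := ∞) (by norm_cast)
    have : ContMDiffVectorBundle 1 E (TangentSpace I : M → Type _) I :=
      TangentBundle.contMDiffVectorBundle
    exact ContMDiff.const_smul_section hG
  have hsub : Icc 0 a ⊆ {t | t + -a ∈ {t : ℝ | t * (-1) ∈ Icc 0 a}} := fun t ht ↦ by
    simp only [mem_ofPred_eq, mem_Icc] at ht ⊢
    constructor <;> linarith
  have := IsMIntegralCurveOn.eq_of_eq_zero hG' (((hγ.comp_mul (-1)).comp_add (-a)).mono hsub)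
    (((hγ'.comp_mul (-1)).comp_add (-a)).mono hsub) (by simpa using h) ha
  simpa using this

variable {φ : ℝ → M → M} (hφ : IsFlowOf G φ)
include hφ

omit [FiniteDimensional ℝ E] [IsManifold I ∞ M] [T2Space M] [CompactSpace M] hG in
theorem LinearPoincareFlow.IsFlowOf.isMIntegralCurveOn_Ici (x : M) :
    IsMIntegralCurveOn (fun t ↦ φ t x) G (Ici 0) :=
  (hφ.isMIntegralCurveOn x).mono fun t ht ↦ hφ.mem_flowDomain x t ht

/-- The flow of a vector field is a partial flow on the manifold. -/
theorem LinearPoincareFlow.IsFlowOf.isPartialFlow : IsPartialFlow univ (flowDomain G) φ := by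
  have hadd (x : M) (s t : ℝ) (hs : 0 ≤ s) (ht : 0 ≤ t) : φ (s + t) x = φ s (φ t x) := by
    have h1 := ((hφ.isMIntegralCurveOn_Ici x).comp_add t).mono
      (s' := Icc 0 s) fun u hu ↦ add_nonneg hu.1 ht
    have h2 := (hφ.isMIntegralCurveOn_Ici (φ t x)).mono (s' := Icc 0 s) fun u hu ↦ hu.1
    exact IsMIntegralCurveOn.eq_of_eq_zero hG h1 h2 (by simp [hφ.map_zero]) hs
  have hinj (x y : M) (s : ℝ) (hs : 0 ≤ s) (h : φ s x = φ s y) : x = y := by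
    have := IsMIntegralCurveOn.eq_of_eq_right hG
      ((hφ.isMIntegralCurveOn_Ici x).mono fun u hu ↦ hu.1)
      ((hφ.isMIntegralCurveOn_Ici y).mono fun u hu ↦ hu.1) h hs
    simpa [hφ.map_zero] using this
  have hneg (x : M) (s : ℝ) (hs : 0 ≤ s) (h : -s ∈ flowDomain G x) : φ s (φ (-s) x) = x := by
    have hsub : uIcc 0 (-s) ⊆ flowDomain G x := by
      obtain ⟨γ, h0, hγ⟩ := h
      exact fun u hu ↦ ⟨γ, h0, hγ.mono (uIcc_subset_uIcc_left hu)⟩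
    have h1 := ((hφ.isMIntegralCurveOn x).comp_add (-s)).mono
      (s' := Icc 0 s) fun u hu ↦ hsub (by
        rw [uIcc_of_ge (by linarith)]; exact ⟨by linarith [hu.1], by linarith [hu.2]⟩)
    have h2 := (hφ.isMIntegralCurveOn_Ici (φ (-s) x)).mono (s' := Icc 0 s) fun u hu ↦ hu.1
    have := IsMIntegralCurveOn.eq_of_eq_zero hG h1 h2 (by simp [hφ.map_zero]) hs
    simpa [hφ.map_zero] using this.symm
  have hmem (x : M) (s : ℝ) (hs : 0 ≤ s) : -s ∈ flowDomain G (φ s x) := by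
    refine ⟨fun u ↦ φ (u + s) x, by simp, ?_⟩
    refine ((hφ.isMIntegralCurveOn_Ici x).comp_add s).mono fun u hu ↦ ?_
    rw [uIcc_of_ge (by linarith)] at hu
    change 0 ≤ u + s
    linarith [hu.1]
  exact
    { mem_of_nonneg := fun x _ t ht ↦ hφ.mem_flowDomain x t ht
      mapsTo := fun _ _ _ _ ↦ mem_univ _
      map_zero := fun x _ ↦ hφ.map_zero x
      map_add := fun x _ s t hs ht ↦ hadd x s t hs ht
      neg_mem := fun x _ s hs ↦ hmem x s hs
      -- By `hneg`, $\phi_s\phi_{-s}$ fixes $\phi_s x$; injectivity of $\phi_s$ cancels the outer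
      -- map.
      map_neg := fun x _ s hs ↦ hinj _ _ s hs (hneg _ s hs (hmem x s hs))
      exists_of_neg_mem := fun x _ s hs h ↦ ⟨φ (-s) x, mem_univ _, hneg x s hs h⟩ }

end Flow

/-! ### Differentiability of inverses on sets that need not be open. -/

section LocalInverse

variable {E : Type*} [NormedAddCommGroup E] [NormedSpace ℝ E]
  {H : Type*} [TopologicalSpace H] {I : ModelWithCorners ℝ E H}
  {M : Type*} [TopologicalSpace M] [ChartedSpace H M]

/-- A continuous right inverse on `s` of a map `f` with invertible derivative is differentiable
within `s`. -/
theorem HasMFDerivAt.hasMFDerivWithinAt_rightInverse {f g : M → M} {s : Set M} {y : M}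
    {A : E ≃L[ℝ] E} (hf : HasMFDerivAt I I f (g y) (A : E →L[ℝ] E)) (hfg : ∀ z ∈ s, f (g z) = z)
    (hy : y ∈ s) (hg : ContinuousWithinAt g s y) :
    HasMFDerivWithinAt I I g s y (A.symm : E →L[ℝ] E) := by
  refine ⟨hg, ?_⟩
  have hf2 : HasFDerivWithinAt
      (extChartAt I (f (g y)) ∘ f ∘ (extChartAt I (g y)).symm) (A : E →L[ℝ] E) (range I)
      (extChartAt I (g y) (g y)) := hf.2
  rw [hfg y hy] at hf2
  have hgy : writtenInExtChartAt I I y g (extChartAt I y y) = extChartAt I (g y) (g y) := by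
    simp only [writtenInExtChartAt, Function.comp_apply, extChartAt_to_inv]
  have hr (x z : M) : extChartAt I x z ∈ range I := ⟨chartAt H x z, rfl⟩
  have hsymm : Tendsto (extChartAt I y).symm
      (𝓝[(extChartAt I y).symm ⁻¹' s ∩ range I] (extChartAt I y y)) (𝓝[s] y) := by
    refine tendsto_nhdsWithin_iff.2 ⟨?_, ?_⟩
    · have := (continuousAt_extChartAt_symm (I := I) y).tendsto
      rw [extChartAt_to_inv] at this
      exact this.mono_left nhdsWithin_le_nhds
    · filter_upwards [self_mem_nhdsWithin] with p hp using hp.1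
  have hcomp := hg.tendsto.comp hsymm
  rw [← hgy] at hf2
  refine HasFDerivWithinAt.of_local_left_inverse ?_ hf2 ⟨?_, hr _ _⟩ ?_
  · refine tendsto_nhdsWithin_iff.2 ⟨?_, Eventually.of_forall fun p ↦ hr _ _⟩
    rw [hgy]
    exact (continuousAt_extChartAt (g y)).tendsto.comp hcomp
  · rwa [mem_preimage, extChartAt_to_inv]
  · have h1 : ∀ᶠ p in 𝓝[(extChartAt I y).symm ⁻¹' s ∩ range I] (extChartAt I y y),
        p ∈ (extChartAt I y).target :=
      nhdsWithin_mono _ inter_subset_right (extChartAt_target_mem_nhdsWithin y)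
    have h2 := hcomp.eventually (extChartAt_source_mem_nhds (I := I) (g y))
    filter_upwards [h1, h2, self_mem_nhdsWithin] with p hp1 hp2 hp3
    simp only [writtenInExtChartAt, Function.comp_apply] at hp2 ⊢
    rw [(extChartAt I (g y)).left_inv hp2, hfg _ hp3.1, (extChartAt I y).right_inv hp1]

end LocalInverse

/-! ### The derivative of the flow. -/

section FlowDeriv

variable {E : Type*} [NormedAddCommGroup E] [NormedSpace ℝ E] [FiniteDimensional ℝ E]
  {H : Type*} [TopologicalSpace H] {I : ModelWithCorners ℝ E H}
  {M : Type*} [TopologicalSpace M] [ChartedSpace H M] [IsManifold I ∞ M]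
  [T2Space M] [CompactSpace M] {G : (x : M) → TangentSpace I x}
  (hG : ContMDiff I I.tangent 1 (fun x ↦ (⟨x, G x⟩ : TangentBundle I M)))
  {φ : ℝ → M → M} (hφ : IsFlowOf G φ)

include hG hφ

/-- For times up to $\tau$ the derivative is, in a flow box, an injective fundamental solution;
longer times are compositions of such maps. -/
theorem LinearPoincareFlow.IsFlowOf.mdifferentiableAt_and_injective {t : ℝ} (ht : 0 ≤ t) (x : M) :
    MDifferentiableAt I I (φ t) x ∧ Function.Injective (mfderiv I I (φ t) x) := by
  obtain ⟨τ, hτ, hbox⟩ := exists_uniform_isFlowBox hG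
  have hshort {t : ℝ} (ht : 0 ≤ t) (htτ : t ≤ τ) (x : M) :
      MDifferentiableAt I I (φ t) x ∧ Function.Injective (mfderiv I I (φ t) x) := by
    obtain ⟨x₀, r, B, L, h1, hx, h3, h4⟩ := hbox x
    obtain ⟨Z, -, -, hZ⟩ := h1.exists_fundamental_solution hG hφ.map_zero
      (fun x ↦ (hφ.isMIntegralCurveOn_Ici x).mono fun s hs ↦ hs.1) hτ.le h3 h4 hx
    obtain ⟨hinj, hd, hZt⟩ := hZ t ⟨ht, htτ⟩
    have hx' : x ∈ (extChartAt I x₀).source := hx.1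
    refine ⟨hd, fun v w hvw ↦ (chartDeriv_bijective hx').1 (hinj ?_)⟩
    rw [← hZt, ← hZt, hvw]
  obtain ⟨n, hn⟩ := exists_nat_ge (t / τ)
  rw [div_le_iff₀ hτ] at hn
  induction n generalizing t x with
  | zero => exact hshort ht (hn.trans (by simpa using hτ.le)) x
  | succ n ih =>
    rcases le_total t τ with htτ | htτ
    · exact hshort ht htτ x
    · have h0 : 0 ≤ t - τ := sub_nonneg.2 htτ
      have h1 := hshort hτ.le le_rfl (φ (t - τ) x)
      have h2 := ih h0 x (by push_cast at hn; linarith)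
      have heq : φ t = φ τ ∘ φ (t - τ) := by
        ext y
        rw [Function.comp_apply, ← (hφ.isPartialFlow hG).map_add y (mem_univ _) τ _ hτ.le h0,
          add_sub_cancel]
      rw [heq]
      refine ⟨h1.1.comp x h2.1, ?_⟩
      rw [mfderiv_comp x h1.1 h2.1]
      exact h1.2.comp h2.2

omit [FiniteDimensional ℝ E] [IsManifold I ∞ M] [T2Space M] [CompactSpace M] hG hφ in
theorem LinearPoincareFlow.flowDeriv_of_domain_eq_univ {G : (x : M) → TangentSpace I x}
    {φ : ℝ → M → M} {t : ℝ} (h : ∀ x, t ∈ flowDomain G x) (v : TangentBundle I M) :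
    flowDeriv G φ t v = ⟨φ t v.1, mfderiv I I (φ t) v.1 v.2⟩ := by
  have : {x | t ∈ flowDomain G x} = univ := eq_univ_of_forall h
  rw [flowDeriv, this, tangentMapWithin_univ, tangentMap]

/-- The domain of $\phi_{-s}$ is the image of $\phi_s$, a closed embedding because $M$ is compact
Hausdorff. There $\phi_{-s}$ is a continuous inverse of a map whose derivative is bijective, by
injectivity and equality of dimensions. Surjectivity of this derivative also makes derivatives
within the image unique, so that $D\phi_{-s}$ is well determined on a domain that may fail to be
open. -/
theorem LinearPoincareFlow.IsFlowOf.mdifferentiableWithinAt_neg {s : ℝ} (hs : 0 ≤ s) (x : M) :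
    MDifferentiableWithinAt I I (φ (-s)) {y | -s ∈ flowDomain G y} (φ s x) ∧
    UniqueMDiffWithinAt I {y | -s ∈ flowDomain G y} (φ s x) := by
  have hP := hφ.isPartialFlow hG
  have hset : {y | -s ∈ flowDomain G y} = range (φ s) := by
    ext y
    constructor
    · intro hy
      obtain ⟨w, -, hw⟩ := hP.exists_of_neg_mem y (mem_univ _) s hs hy
      exact ⟨w, hw⟩
    · rintro ⟨w, rfl⟩
      exact hP.neg_mem w (mem_univ _) s hs
  have hleft (y : M) : φ (-s) (φ s y) = y := hP.map_neg y (mem_univ _) s hs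
  have hd (y : M) := (hφ.mdifferentiableAt_and_injective hG hs y)
  have hcont : Continuous (φ s) := continuous_iff_continuousAt.2 fun y ↦ (hd y).1.continuousAt
  have hemb : IsClosedEmbedding (φ s) :=
    hcont.isClosedEmbedding (Function.LeftInverse.injective hleft)
  rw [hset]
  set D : E →L[ℝ] E := mfderiv I I (φ s) x with hD
  have hDinj : Function.Injective D := (hd x).2
  have hDsurj : Function.Surjective D := LinearMap.injective_iff_surjective.1 hDinj
  set A : E ≃L[ℝ] E := ContinuousLinearEquiv.ofBijective D
    (LinearMap.ker_eq_bot.2 hDinj) (LinearMap.range_eq_top.2 hDsurj) with hA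
  have hx : HasMFDerivAt I I (φ s) x D := (hd x).1.hasMFDerivAt
  constructor
  · have hx' : HasMFDerivAt I I (φ s) (φ (-s) (φ s x)) (A : E →L[ℝ] E) := by
      rw [hleft]; exact hx
    refine (hx'.hasMFDerivWithinAt_rightInverse ?_ (mem_range_self x) ?_).mdifferentiableWithinAt
    · rintro _ ⟨w, rfl⟩
      rw [hleft]
    · rw [ContinuousWithinAt, hemb.isEmbedding.isInducing.nhds_eq_comap, tendsto_comap_iff, hleft]
      refine (tendsto_id.mono_left nhdsWithin_le_nhds).congr' ?_
      filter_upwards [self_mem_nhdsWithin] with y hy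
      obtain ⟨w, rfl⟩ := hy
      simp [hleft]
  · rw [← image_univ]
    exact (uniqueMDiffWithinAt_univ I).image_denseRange hx.hasMFDerivWithinAt hDsurj.denseRange

theorem LinearPoincareFlow.IsFlowOf.mdifferentiableOn (t : ℝ) :
    MDifferentiableOn I I (φ t) {x | t ∈ flowDomain G x} := by
  have hP := hφ.isPartialFlow hG
  intro x hx
  rcases le_total 0 t with ht | ht
  · exact (hφ.mdifferentiableAt_and_injective hG ht x).1.mdifferentiableWithinAt
  · obtain ⟨w, -, rfl⟩ := hP.exists_of_neg_mem x (mem_univ _) (-t) (neg_nonneg.2 ht)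
      (by simpa using hx)
    simpa using (hφ.mdifferentiableWithinAt_neg hG (neg_nonneg.2 ht) w).1

omit [FiniteDimensional ℝ E] [IsManifold I ∞ M] [T2Space M] [CompactSpace M] hG in
theorem LinearPoincareFlow.IsFlowOf.flowDeriv_of_nonneg {t : ℝ} (ht : 0 ≤ t)
    (v : TangentBundle I M) :
    flowDeriv G φ t v = ⟨φ t v.1, mfderiv I I (φ t) v.1 v.2⟩ :=
  flowDeriv_of_domain_eq_univ (fun x ↦ hφ.mem_flowDomain x t ht) v

theorem LinearPoincareFlow.IsFlowOf.flowDeriv_neg {s : ℝ} (hs : 0 ≤ s) (v : TangentBundle I M) :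
    flowDeriv G φ (-s) (flowDeriv G φ s v) = v := by
  have hP := hφ.isPartialFlow hG
  obtain ⟨h1, h2⟩ := hφ.mdifferentiableWithinAt_neg hG hs v.1
  have h3 := (hφ.mdifferentiableAt_and_injective hG hs v.1).1
  have hid : φ (-s) ∘ φ s = id := funext fun y ↦ hP.map_neg y (mem_univ _) s hs
  have hset : {x | s ∈ flowDomain G x} = univ :=
    eq_univ_of_forall fun x ↦ hφ.mem_flowDomain x s hs
  rw [flowDeriv, flowDeriv, hset, ← tangentMapWithin_comp_at v h1 h3.mdifferentiableWithinAt
    (fun y _ ↦ hP.neg_mem y (mem_univ _) s hs) (uniqueMDiffWithinAt_univ I), hid,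
    tangentMapWithin_univ, tangentMap_id]
  rfl

/-- The derivative of the flow is a partial flow on the tangent bundle. -/
theorem LinearPoincareFlow.IsFlowOf.isPartialFlow_flowDeriv :
    IsPartialFlow univ (fun v : TangentBundle I M ↦ flowDomain G v.1) (flowDeriv G φ) := by
  have hP := hφ.isPartialFlow hG
  exact
    { mem_of_nonneg := fun v _ ↦ hP.mem_of_nonneg v.1 (mem_univ _)
      mapsTo := fun _ _ _ _ ↦ mem_univ _
      map_zero := fun v _ ↦ by
        have : φ 0 = id := funext hφ.map_zero
        rw [hφ.flowDeriv_of_nonneg le_rfl, this, mfderiv_id]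
        rfl
      map_add := fun v _ s t hs ht ↦ by
        have : φ (s + t) = φ s ∘ φ t := funext fun x ↦ hP.map_add x (mem_univ _) s t hs ht
        rw [hφ.flowDeriv_of_nonneg hs, hφ.flowDeriv_of_nonneg ht,
          hφ.flowDeriv_of_nonneg (add_nonneg hs ht), this, mfderiv_comp v.1
            (hφ.mdifferentiableAt_and_injective hG hs _).1
            (hφ.mdifferentiableAt_and_injective hG ht _).1]
        rfl
      neg_mem := fun v _ s hs ↦ by
        rw [hφ.flowDeriv_of_nonneg hs]
        exact hP.neg_mem v.1 (mem_univ _) s hs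
      map_neg := fun v _ s hs ↦ hφ.flowDeriv_neg hG hs v
      exists_of_neg_mem := fun v _ s hs h ↦ by
        obtain ⟨x, -, hx⟩ := hP.exists_of_neg_mem v.1 (mem_univ _) s hs h
        obtain ⟨y, v⟩ := v
        obtain rfl : φ s x = y := hx
        have hinj := (hφ.mdifferentiableAt_and_injective hG hs x).2
        have hfin : FiniteDimensional ℝ (TangentSpace I x) := inferInstanceAs (FiniteDimensional ℝ E)
        have hsurj : Function.Surjective (mfderiv I I (φ s) x) :=
          LinearMap.injective_iff_surjective.1 hinj
        obtain ⟨w, hw⟩ := hsurj v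
        refine ⟨⟨x, w⟩, mem_univ _, ?_⟩
        rw [hφ.flowDeriv_of_nonneg hs]
        exact congrArg (TotalSpace.mk (φ s x)) hw }

end FlowDeriv

/-! ### Derivatives of functions on the tangent bundle along the flow. -/

section FlowRate

variable {E : Type*} [NormedAddCommGroup E] [NormedSpace ℝ E]
  {H : Type*} [TopologicalSpace H] {I : ModelWithCorners ℝ E H}
  {M : Type*} [TopologicalSpace M] [ChartedSpace H M]

/-- The right derivative at time zero of the function `N` along the orbit of a tangent vector. -/
noncomputable def flowRate (G : (x : M) → TangentSpace I x) (φ : ℝ → M → M)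
    (N : TangentBundle I M → ℝ) (w : TangentBundle I M) : ℝ :=
  derivWithin (fun s ↦ N (flowDeriv G φ s w)) (Ici 0) 0

/-- The expression in the chart around `x₀` of the derivative of the function `N` along the orbits
of the derivative of the flow. -/
noncomputable def chartFlowRate [IsManifold I ∞ M] (G : (x : M) → TangentSpace I x)
    (N : TangentBundle I M → ℝ) (x₀ : M) (q : E × E) : ℝ :=
  fderivWithin ℝ (chartFun N x₀) ((extChartAt I x₀).target ×ˢ univ) q
    (chartField G x₀ q.1, chartFieldDeriv G x₀ q.1 q.2)

variable [FiniteDimensional ℝ E] [IsManifold I ∞ M] {G : (x : M) → TangentSpace I x}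
  (hG : ContMDiff I I.tangent 1 (fun x ↦ (⟨x, G x⟩ : TangentBundle I M)))
  {φ : ℝ → M → M} (hφ : IsFlowOf G φ) {N : TangentBundle I M → ℝ}
  (hN : ContMDiff I.tangent 𝓘(ℝ) 1 N)

include hG in
omit [FiniteDimensional ℝ E] in
theorem continuousOn_chartFlowRate (hN : ContMDiff I.tangent 𝓘(ℝ) 1 N) (x₀ : M) :
    ContinuousOn (chartFlowRate G N x₀) ((extChartAt I x₀).target ×ˢ univ) := by
  have h1 := (contDiffOn_chartFun hN x₀).continuousOn_fderivWithin
    ((uniqueDiffOn_extChartAt_target x₀).prod uniqueDiffOn_univ) le_rfl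
  have hfst : MapsTo Prod.fst ((extChartAt I x₀).target ×ˢ (univ : Set E))
      (extChartAt I x₀).target := fun q hq ↦ hq.1
  refine h1.clm_apply (ContinuousOn.prodMk ?_ (ContinuousOn.clm_apply ?_ continuousOn_snd))
  · exact (contDiffOn_chartField hG x₀).continuousOn.comp continuousOn_fst hfst
  · exact (continuousOn_chartFieldDeriv hG x₀).comp continuousOn_fst hfst

variable [T2Space M]

include hG hφ hN

/-- The derivative of the function `N` along the orbit of a tangent vector, in a flow box. -/
theorem IsFlowBox.hasDerivWithinAt_comp_flowDeriv {x₀ : M} {r B L a : ℝ}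
    (hbox : IsFlowBox G x₀ r B L) (ha0 : 0 ≤ a) (ha : B * a ≤ r / 4) (haL : 2 * L * a ≤ 1)
    {v : TangentBundle I M} (hv : v.1 ∈ boxNhd I x₀ (r / 2)) {t : ℝ} (ht : t ∈ Icc 0 a) :
    HasDerivWithinAt (fun s ↦ N (flowDeriv G φ s v))
      (chartFlowRate G N x₀
        (extChartAt I.tangent (⟨x₀, 0⟩ : TangentBundle I M) (flowDeriv G φ t v)))
      (Icc 0 a) t := by
  have hint (x : M) : IsMIntegralCurveOn (fun t ↦ φ t x) G (Icc 0 a) :=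
    (hφ.isMIntegralCurveOn_Ici x).mono fun s hs ↦ hs.1
  obtain ⟨Z, -, hZ, hZt⟩ := hbox.exists_fundamental_solution hG hφ.map_zero hint ha0 ha haL hv
  have hm {s : ℝ} (hs : s ∈ Icc 0 a) :=
    hbox.mem_of_isMIntegralCurveOn (hint v.1) ha (by simpa [hφ.map_zero] using hv) hs
  have hchart {s : ℝ} (hs : s ∈ Icc 0 a) :
      extChartAt I.tangent (⟨x₀, 0⟩ : TangentBundle I M) (flowDeriv G φ s v) =
        (extChartAt I x₀ (φ s v.1), Z s (chartDeriv x₀ v.1 v.2)) := by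
    rw [extChartAt_tangent_apply (hm hs).1, hφ.flowDeriv_of_nonneg hs.1, (hZt s hs).2.2]
  have hNs {s : ℝ} (hs : s ∈ Icc 0 a) : N (flowDeriv G φ s v) =
      chartFun N x₀ (extChartAt I x₀ (φ s v.1), Z s (chartDeriv x₀ v.1 v.2)) := by
    rw [← hchart hs, extChartAt_tangent_apply (hm hs).1, chartFun_apply N (hm hs).1]
  have hmem {s : ℝ} (hs : s ∈ Icc 0 a) :
      (extChartAt I x₀ (φ s v.1), Z s (chartDeriv x₀ v.1 v.2)) ∈
        (extChartAt I x₀).target ×ˢ (univ : Set E) :=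
    ⟨(extChartAt I x₀).map_source (hm hs).1, mem_univ _⟩
  rw [hchart ht, chartFlowRate]
  have h1 := ((contDiffOn_chartFun hN x₀).differentiableOn one_ne_zero _
    (hmem ht)).hasFDerivWithinAt
  -- The pair of base point and fibre coordinate satisfies $p'=G(p)$, $\xi'=DG(p)\xi$; composing
  -- with `chartFun` gives exactly `chartFlowRate`.
  have h2 := ((hint v.1).hasDerivWithinAt_extChartAt ht (hm ht).1).prodMk
    ((hZ t ht).clm_apply (hasDerivWithinAt_const t _ (chartDeriv x₀ v.1 v.2)))
  have h3 := h1.comp_hasDerivWithinAt t h2 fun s hs ↦ hmem hs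
  refine (h3.congr (fun s hs ↦ hNs hs) (hNs ht)).congr_deriv ?_
  simp

/-- Compares the chart-free rate with its chart formula: the rate exists by the formula, and
inherits its continuity. -/
theorem IsFlowBox.hasDerivWithinAt_flowRate {x₀ : M} {r B L a : ℝ}
    (hbox : IsFlowBox G x₀ r B L) (ha0 : 0 < a) (ha : B * a ≤ r / 4) (haL : 2 * L * a ≤ 1)
    {v : TangentBundle I M} (hv : v.1 ∈ boxNhd I x₀ (r / 2)) :
    HasDerivWithinAt (fun s ↦ N (flowDeriv G φ s v)) (flowRate G φ N v) (Ici 0) 0 ∧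
    flowRate G φ N v =
      chartFlowRate G N x₀ (extChartAt I.tangent (⟨x₀, 0⟩ : TangentBundle I M) v) := by
  have h := hbox.hasDerivWithinAt_comp_flowDeriv hG hφ hN ha0.le ha haL hv (t := 0)
    ⟨le_rfl, ha0.le⟩
  have h0 : flowDeriv G φ 0 v = v := by
    have : φ 0 = id := funext hφ.map_zero
    rw [hφ.flowDeriv_of_nonneg le_rfl, this, mfderiv_id]
    rfl
  rw [h0] at h
  generalize chartFlowRate G N x₀ (extChartAt I.tangent (⟨x₀, 0⟩ : TangentBundle I M) v) = c at h ⊢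
  have hmem : Icc 0 a ∈ 𝓝[≥] (0 : ℝ) := Icc_mem_nhdsGE ha0
  have h' : HasDerivWithinAt (fun s ↦ N (flowDeriv G φ s v)) c (Ici 0) 0 :=
    HasDerivWithinAt.mono_of_mem_nhdsWithin h hmem
  have heq : flowRate G φ N v = c := h'.derivWithin (uniqueDiffWithinAt_Ici 0)
  exact ⟨by rwa [heq], heq⟩

variable [CompactSpace M]

theorem continuous_flowRate : Continuous (flowRate G φ N) := by
  obtain ⟨τ, hτ, hbox⟩ := exists_uniform_isFlowBox hG
  refine continuous_iff_continuousAt.2 fun w ↦ ?_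
  obtain ⟨x₀, r, B, L, h1, hx, h3, h4⟩ := hbox w.1
  have hsrc : w ∈ (extChartAt I.tangent (⟨x₀, 0⟩ : TangentBundle I M)).source :=
    mem_extChartAt_tangent_source.2 hx.1
  have hc : ContinuousOn (fun w ↦ chartFlowRate G N x₀
      (extChartAt I.tangent (⟨x₀, 0⟩ : TangentBundle I M) w))
      (extChartAt I.tangent (⟨x₀, 0⟩ : TangentBundle I M)).source := by
    refine (continuousOn_chartFlowRate hG hN x₀).comp (continuousOn_extChartAt _) fun v hv ↦ ?_
    rw [← extChartAt_tangent_target]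
    exact (extChartAt I.tangent _).map_source hv
  refine (hc.continuousAt ((isOpen_extChartAt_source _).mem_nhds hsrc)).congr ?_
  have : IsManifold I 1 M := isManifold_one_of_infty
  have hcont : Continuous (fun v : TangentBundle I M ↦ v.1) :=
    FiberBundle.continuous_proj E (TangentSpace I : M → Type _)
  filter_upwards [hcont.continuousAt.preimage_mem_nhds
    ((isOpen_boxNhd x₀ (r / 2)).mem_nhds hx)] with v hv
  exact (h1.hasDerivWithinAt_flowRate hG hφ hN hτ h3 h4 hv).2.symm

/-- The function `N` along the orbit of `v` under the derivative of the flow is differentiable. -/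
theorem hasDerivWithinAt_comp_flowDeriv_zero (v : TangentBundle I M) :
    HasDerivWithinAt (fun s ↦ N (flowDeriv G φ s v)) (flowRate G φ N v) (flowDomain G v.1) 0 := by
  obtain ⟨τ, hτ, hbox⟩ := exists_uniform_isFlowBox hG
  have hP := hφ.isPartialFlow_flowDeriv hG
  -- If the orbit extends backwards, step back by less than $\tau$ to $w$: time $0$ of $v$ is then
  -- an interior time in the box of $w$, where the derivative is two-sided. Otherwise the domain
  -- lies in $[0,\infty)$ and the one-sided derivative is enough.
  by_cases hneg : ∃ t ∈ flowDomain G v.1, t < 0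
  · obtain ⟨t, htJ, ht⟩ := hneg
    obtain ⟨t, htJ, ht, htτ⟩ : ∃ t ∈ flowDomain G v.1, t < 0 ∧ -τ < t := by
      refine ⟨max t (-(τ / 2)), hP.uIcc_subset (mem_univ v) htJ ?_, ?_, ?_⟩
      · rw [uIcc_of_ge ht.le]
        exact ⟨le_max_left _ _, max_le ht.le (by linarith)⟩
      · exact max_lt ht (by linarith)
      · exact lt_max_of_lt_right (by linarith)
    set w := flowDeriv G φ t v with hw
    obtain ⟨x₀, r, B, L, h1, hx, h3, h4⟩ := hbox w.1
    have hd := h1.hasDerivWithinAt_comp_flowDeriv hG hφ hN hτ.le h3 h4 hx (t := -t)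
      ⟨by linarith, by linarith⟩
    have hd' := hd.hasDerivAt (Icc_mem_nhds (by linarith) (by linarith))
    set c := chartFlowRate G N x₀
      (extChartAt I.tangent (⟨x₀, 0⟩ : TangentBundle I M) (flowDeriv G φ (-t) w))
    have hd'' : HasDerivAt (fun s ↦ N (flowDeriv G φ (s - t) w)) c 0 := by
      have := HasDerivAt.comp_sub_const (0 : ℝ) t (f := fun s ↦ N (flowDeriv G φ s w)) (f' := c)
        (by rwa [zero_sub])
      exact this
    have heq {s : ℝ} (hs : t ≤ s) : flowDeriv G φ (s - t) w = flowDeriv G φ s v := by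
      have := (hP.add_mem_and_map_add (mem_univ v) htJ (u := s - t)
        (hP.mem_of_nonneg w (mem_univ _) _ (sub_nonneg.2 hs))).2
      rw [← this, add_sub_cancel]
    have hd3 : HasDerivAt (fun s ↦ N (flowDeriv G φ s v)) c 0 := by
      refine hd''.congr_of_eventuallyEq ?_
      filter_upwards [Ioi_mem_nhds ht] with s hs
      rw [heq (le_of_lt hs)]
    have : flowRate G φ N v = c :=
      hd3.hasDerivWithinAt.derivWithin (uniqueDiffWithinAt_Ici 0)
    rw [this]
    exact hd3.hasDerivWithinAt
  · push Not at hneg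
    obtain ⟨x₀, r, B, L, h1, hx, h3, h4⟩ := hbox v.1
    exact (h1.hasDerivWithinAt_flowRate hG hφ hN hτ h3 h4 hx).1.mono hneg

/-- A continuous function is bounded on the image of the compact product of a chart ball and a ball
of fibre coordinates. Working with coordinates avoids any metric here, and any appeal to compactness
of the unit tangent bundle. -/
theorem exists_abs_flowRate_le (x₀ : M) : ∃ U ∈ 𝓝 x₀, ∀ R : ℝ, ∃ C, ∀ w : TangentBundle I M,
    w.1 ∈ U → ‖(trivializationAt E (TangentSpace I) x₀ w).2‖ ≤ R → |flowRate G φ N w| ≤ C := by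
  obtain ⟨r, B, L, h⟩ := exists_isFlowBox hG x₀
  refine ⟨boxNhd I x₀ r, (isOpen_boxNhd x₀ r).mem_nhds (mem_boxNhd_self x₀ h.r_pos), fun R ↦ ?_⟩
  have : ProperSpace E := FiniteDimensional.proper ℝ E
  have : IsManifold I 1 M := isManifold_one_of_infty
  set e := extChartAt I.tangent (⟨x₀, 0⟩ : TangentBundle I M) with he
  have hK : IsCompact (chartBall I x₀ r ×ˢ Metric.closedBall (0 : E) R) :=
    (isCompact_chartBall x₀ r).prod (isCompact_closedBall _ _)
  have hQ : IsCompact (e.symm '' (chartBall I x₀ r ×ˢ Metric.closedBall (0 : E) R)) := by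
    refine hK.image_of_continuousOn ((continuousOn_extChartAt_symm _).mono ?_)
    rw [extChartAt_tangent_target]
    exact prod_mono h.subset_target (subset_univ _)
  obtain ⟨C, hC⟩ := hQ.exists_bound_of_continuousOn (continuous_flowRate hG hφ hN).continuousOn
  refine ⟨C, fun w hw hR ↦ hC w ⟨e w, ?_, e.left_inv (mem_extChartAt_tangent_source.2 hw.1)⟩⟩
  rw [he, extChartAt_tangent_apply hw.1]
  rw [chartDeriv_eq_trivializationAt hw.1] at hR
  exact ⟨⟨Metric.ball_subset_closedBall hw.2, extChartAt_mem_range hw.1⟩, by simpa using hR⟩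

omit hN in
/-- The derivative of the flow maps the vector field to itself. -/
theorem LinearPoincareFlow.IsFlowOf.flowDeriv_field {x : M} {t : ℝ} (ht : t ∈ flowDomain G x) :
    flowDeriv G φ t ⟨x, G x⟩ = ⟨φ t x, G (φ t x)⟩ := by
  have hP := hφ.isPartialFlow hG
  have hP' := hφ.isPartialFlow_flowDeriv hG
  have hpos (x : M) {t : ℝ} (ht : 0 ≤ t) : flowDeriv G φ t ⟨x, G x⟩ = ⟨φ t x, G (φ t x)⟩ := by
    -- Differentiate $\phi_t(\phi_s x)=\phi_{s+t}x$ at $s=0$: the chain rule gives $D\phi_t\,G(x)$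
    -- on the left, the integral curve equation gives $G(\phi_t x)$ on the right.
    have hd := (hφ.mdifferentiableAt_and_injective hG ht (φ 0 x)).1.hasMFDerivAt
    have h1 := hd.comp_hasMFDerivWithinAt (0 : ℝ)
      (hφ.isMIntegralCurveOn_Ici x (0 : ℝ) (self_mem_Ici))
    have h2 := ((hφ.isMIntegralCurveOn_Ici x).comp_add t).mono (s' := Ici 0)
      (fun s (hs : 0 ≤ s) ↦ add_nonneg hs ht) (0 : ℝ) self_mem_Ici
    have h3 := h1.congr_of_eventuallyEq (f₁ := (fun s ↦ φ s x) ∘ (· + t)) ?_ ?_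
    · have huniq : UniqueMDiffWithinAt 𝓘(ℝ, ℝ) (Ici (0 : ℝ)) 0 :=
        uniqueMDiffWithinAt_iff_uniqueDiffWithinAt.2 (uniqueDiffWithinAt_Ici 0)
      have h4 : (mfderiv I I (φ t) (φ 0 x) ((1 : ℝ) • G (φ 0 x)) : E) =
          (1 : ℝ) • G (φ (0 + t) x) := congr($(huniq.eq h3 h2) (1 : ℝ))
      rw [one_smul, one_smul, hφ.map_zero, zero_add] at h4
      rw [hφ.flowDeriv_of_nonneg ht]
      exact congrArg (TotalSpace.mk (φ t x)) h4
    · filter_upwards [self_mem_nhdsWithin] with s hs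
      have := hP.map_add x (mem_univ _) t s ht hs
      simpa [add_comm] using this
    · simp [hφ.map_zero]
  rcases le_total 0 t with h0 | h0
  · exact hpos x h0
  · obtain ⟨y, -, hy⟩ := hP.exists_of_neg_mem x (mem_univ _) (-t) (neg_nonneg.2 h0)
      (by simpa using ht)
    have h1 := hpos y (neg_nonneg.2 h0)
    have h2 := hP'.map_neg ⟨y, G y⟩ (mem_univ _) (-t) (neg_nonneg.2 h0)
    have h3 := hP.map_neg y (mem_univ _) (-t) (neg_nonneg.2 h0)
    rw [h1, hy, neg_neg] at h2
    rw [hy, neg_neg] at h3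
    rw [h2, h3]

end FlowRate

/-! ### Restriction of partial flows to invariant subsets. -/

section PartialFlowRestrict

theorem IsPartialFlow.restrict {X : Type*} {S S' : Set X} {J : X → Set ℝ} {A : ℝ → X → X}
    (h : IsPartialFlow S J A) (hS : S' ⊆ S)
    (hiff : ∀ v ∈ S, ∀ t, 0 ≤ t → (A t v ∈ S' ↔ v ∈ S')) : IsPartialFlow S' J A where
  mem_of_nonneg v hv := h.mem_of_nonneg v (hS hv)
  mapsTo v hv t ht := (hiff v (hS hv) t ht).2 hv
  map_zero v hv := h.map_zero v (hS hv)
  map_add v hv := h.map_add v (hS hv)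
  neg_mem v hv := h.neg_mem v (hS hv)
  map_neg v hv := h.map_neg v (hS hv)
  exists_of_neg_mem v hv s hs hJ := by
    obtain ⟨w, hw, rfl⟩ := h.exists_of_neg_mem v (hS hv) s hs hJ
    exact ⟨w, (hiff w hw s hs).1 hv, rfl⟩

end PartialFlowRestrict

/-! ### Integration of bounded derivatives. -/

section Calculus

open MeasureTheory

/-- The fundamental theorem of calculus for a function with bounded derivative. -/
theorem intervalIntegrable_and_integral_eq_of_hasDerivWithinAt_of_bounded {F d : ℝ → ℝ} {t C : ℝ}
    (hF : ∀ s ∈ uIcc 0 t, HasDerivWithinAt F (d s) (uIcc 0 t) s) (hC : ∀ s ∈ uIcc 0 t, |d s| ≤ C) :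
    IntervalIntegrable d volume 0 t ∧ ∫ s in (0 : ℝ)..t, d s = F t - F 0 := by
  have hd {s : ℝ} (hs : s ∈ Ioo (min 0 t) (max 0 t)) : HasDerivAt F (d s) s :=
    (hF s (Ioo_subset_Icc_self hs)).hasDerivAt (Icc_mem_nhds hs.1 hs.2)
  have hint : IntervalIntegrable d volume 0 t := by
    rw [intervalIntegrable_iff, uIoc, integrableOn_Ioc_iff_integrableOn_Ioo]
    -- On the open interval `d` is the derivative of `F`, which is measurable, so boundedness
    -- suffices; continuity of `d` is not needed.
    have h1 : IntegrableOn (deriv F) (Ioo (min 0 t) (max 0 t)) volume := by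
      refine Measure.integrableOn_of_bounded (M := C) (by simp)
        (measurable_deriv F).aestronglyMeasurable ?_
      refine (ae_restrict_iff' measurableSet_Ioo).2 (Eventually.of_forall fun s hs ↦ ?_)
      rw [(hd hs).deriv]
      exact hC s (Ioo_subset_Icc_self hs)
    exact h1.congr_fun (fun s hs ↦ (hd hs).deriv) measurableSet_Ioo
  refine ⟨hint, intervalIntegral.integral_eq_sub_of_hasDeriv_right
    (fun s hs ↦ (hF s hs).continuousWithinAt) (fun s hs ↦ (hd hs).hasDerivWithinAt) hint⟩

end Calculus

/-! ### Growth rates of norms under fibrewise scaling-compatible flows. -/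

section Cocycle

variable {E : Type*} [NormedAddCommGroup E] [NormedSpace ℝ E]
  {H : Type*} [TopologicalSpace H] {I : ModelWithCorners ℝ E H}
  {M : Type*} [TopologicalSpace M] [ChartedSpace H M]
  [RiemannianBundle (fun x : M ↦ TangentSpace I x)]
  {J : M → Set ℝ}

/-- A partial flow on a set of nonzero tangent vectors which commutes with scalings and for which
the squared norm along the orbits of unit vectors `v` has derivative `2 * D v` at time zero. -/
structure IsRateOf (S : Set (TangentBundle I M)) (J : M → Set ℝ)
    (A : ℝ → TangentBundle I M → TangentBundle I M) (D : TangentBundle I M → ℝ) : Prop where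
  isPartialFlow : IsPartialFlow S (fun v ↦ J v.1) A
  ne_zero : ∀ v ∈ S, v.2 ≠ 0
  smul_mem : ∀ v ∈ S, ∀ c : ℝ, c ≠ 0 → (⟨v.1, c • v.2⟩ : TangentBundle I M) ∈ S
  map_smul : ∀ v ∈ S, ∀ c : ℝ, ∀ t, A t ⟨v.1, c • v.2⟩ = ⟨(A t v).1, c • (A t v).2⟩
  hasDerivWithinAt_sq : ∀ v ∈ S, ‖v.2‖ = 1 →
    HasDerivWithinAt (fun s ↦ ‖(A s v).2‖ ^ 2) (2 * D v) (J v.1) 0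
  bounded : ∃ C : ℝ, ∀ v ∈ S, ‖v.2‖ = 1 → |D v| ≤ C

theorem norm_normalize {v : TangentBundle I M} (hv : v.2 ≠ 0) : ‖(normalize v).2‖ = 1 := by
  rw [LinearPoincareFlow.normalize, norm_smul, norm_inv, norm_norm, inv_mul_cancel₀ (norm_ne_zero_iff.2 hv)]

namespace IsRateOf

variable {S : Set (TangentBundle I M)} {A : ℝ → TangentBundle I M → TangentBundle I M}
  {D : TangentBundle I M → ℝ} (h : IsRateOf S J A D)
include h

theorem map_ne_zero {v : TangentBundle I M} (hv : v ∈ S) {t : ℝ} (ht : t ∈ J v.1) :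
    (A t v).2 ≠ 0 :=
  h.ne_zero _ (h.isPartialFlow.map_mem hv ht)

theorem hasDerivWithinAt_log_zero {v : TangentBundle I M} (hv : v ∈ S) (hv1 : ‖v.2‖ = 1) :
    HasDerivWithinAt (fun s ↦ Real.log ‖(A s v).2‖) (D v) (J v.1) 0 := by
  have h0 : ‖(A 0 v).2‖ = 1 := by rw [h.isPartialFlow.map_zero v hv, hv1]
  have h1 := ((h.hasDerivWithinAt_sq v hv hv1).log (by simp [h0])).const_mul (1 / 2 : ℝ)
  have h2 : (fun s ↦ 1 / 2 * Real.log (‖(A s v).2‖ ^ 2)) =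
      fun s ↦ Real.log ‖(A s v).2‖ := by
    funext s
    rw [Real.log_pow]
    push_cast
    ring
  rw [h2, h0] at h1
  refine h1.congr_deriv ?_
  ring

theorem normalize_mem {v : TangentBundle I M} (hv : v ∈ S) : normalize v ∈ S :=
  h.smul_mem v hv _ (inv_ne_zero (norm_ne_zero_iff.2 (h.ne_zero v hv)))

/-- Cocycle property: with $w=A_t v$, $\ln\|A_s v\|=\ln\|A_{s-t}(w/\|w\|)\|+\ln\|w\|$, so the
derivative at time $t$ is the rate of the unit vector $w/\|w\|$ at time $0$. -/
theorem hasDerivWithinAt_log {v : TangentBundle I M} (hv : v ∈ S) {t : ℝ} (ht : t ∈ J v.1) :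
    HasDerivWithinAt (fun s ↦ Real.log ‖(A s v).2‖) (D (normalize (A t v))) (J v.1) t := by
  have hP := h.isPartialFlow
  set w := A t v with hw
  have hwS : w ∈ S := hP.map_mem hv ht
  have hw0 : ‖w.2‖ ≠ 0 := norm_ne_zero_iff.2 (h.ne_zero w hwS)
  have h1 := h.hasDerivWithinAt_log_zero (h.normalize_mem hwS) (norm_normalize (h.ne_zero w hwS))
  have hmaps : MapsTo (fun s ↦ s - t) (J v.1) (J w.1) := fun s hs ↦
    (hP.mem_map_iff hv ht).2 (by simpa using hs)
  have h2 : HasDerivWithinAt (fun s ↦ Real.log ‖(A (s - t) (normalize w)).2‖ + Real.log ‖w.2‖)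
      (D (normalize w)) (J v.1) t := by
    have h3 : HasDerivWithinAt (fun s : ℝ ↦ s - t) 1 (J v.1) t :=
      (hasDerivWithinAt_id t _).sub_const t
    have h4 := HasDerivWithinAt.comp (h₂ := fun s ↦ Real.log ‖(A s (normalize w)).2‖) t
      (by rw [sub_self]; exact h1) h3 hmaps
    simpa using h4.add_const (Real.log ‖w.2‖)
  have heq (s : ℝ) (hs : s ∈ J v.1) : Real.log ‖(A s v).2‖ =
      Real.log ‖(A (s - t) (normalize w)).2‖ + Real.log ‖w.2‖ := by
    have h5 := (hP.add_mem_and_map_add hv ht (hmaps hs)).2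
    rw [add_sub_cancel] at h5
    have h6 : ‖(A (s - t) (normalize w)).2‖ = ‖w.2‖⁻¹ * ‖(A (s - t) w).2‖ := by
      rw [LinearPoincareFlow.normalize, h.map_smul w hwS, norm_smul, norm_inv, norm_norm]
    have h7 : ‖(A (s - t) w).2‖ ≠ 0 := norm_ne_zero_iff.2 (h.map_ne_zero hwS (hmaps hs))
    rw [h5, h6, Real.log_mul (inv_ne_zero hw0) h7, Real.log_inv]
    ring
  exact h2.congr heq (heq t ht)

theorem tendsto_log {v : TangentBundle I M} (hv : v ∈ S) (hv1 : ‖v.2‖ = 1) :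
    Tendsto (fun s : ℝ ↦ s⁻¹ * Real.log ‖(A s v).2‖) (𝓝[{s | s ∈ J v.1 ∧ s ≠ 0}] 0)
      (𝓝 (D v)) := by
  have h1 := hasDerivWithinAt_iff_tendsto_slope.1 (h.hasDerivWithinAt_log_zero hv hv1)
  have h0 : ‖(A 0 v).2‖ = 1 := by rw [h.isPartialFlow.map_zero v hv, hv1]
  refine h1.congr fun s ↦ ?_
  simp [slope, h0]

theorem integral_eq_log {v : TangentBundle I M} (hv : v ∈ S) (hv1 : ‖v.2‖ = 1) {t : ℝ}
    (ht : t ∈ J v.1) :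
    IntervalIntegrable (fun s ↦ D (normalize (A s v))) MeasureTheory.volume 0 t ∧
      Real.log ‖(A t v).2‖ = ∫ s in (0 : ℝ)..t, D (normalize (A s v)) := by
  have hP := h.isPartialFlow
  have hsub := hP.uIcc_subset hv ht
  obtain ⟨C, hC⟩ := h.bounded
  have h0 : ‖(A 0 v).2‖ = 1 := by rw [hP.map_zero v hv, hv1]
  have := intervalIntegrable_and_integral_eq_of_hasDerivWithinAt_of_bounded
    (fun s hs ↦ (h.hasDerivWithinAt_log hv (hsub hs)).mono hsub)
    (fun s hs ↦ hC _ (h.normalize_mem (hP.map_mem hv (hsub hs)))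
      (norm_normalize (h.map_ne_zero hv (hsub hs))))
  exact ⟨this.1, by rw [this.2, h0, Real.log_one, sub_zero]⟩

variable {B : ℝ → TangentBundle I M → TangentBundle I M}
  (hB : ∀ w ∈ S, ∀ t, -t ∈ J w.1 → B t w = A (-t) w)
include hB

/-- Since $B_s=A_{-s}$, the substitution $s\mapsto -s$ turns the difference quotient into minus that
of $A$. -/
theorem tendsto_log_inverse {v : TangentBundle I M} (hv : v ∈ S) (hv1 : ‖v.2‖ = 1) :
    Tendsto (fun s : ℝ ↦ s⁻¹ * Real.log ‖(B s v).2‖) (𝓝[{s | -s ∈ J v.1 ∧ s ≠ 0}] 0)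
      (𝓝 (-D v)) := by
  have hneg : Tendsto (fun s : ℝ ↦ -s) (𝓝[{s | -s ∈ J v.1 ∧ s ≠ 0}] 0)
      (𝓝[{s | s ∈ J v.1 ∧ s ≠ 0}] 0) := by
    refine tendsto_nhdsWithin_iff.2 ⟨?_, ?_⟩
    · have : Tendsto (fun s : ℝ ↦ -s) (𝓝 0) (𝓝 0) := by
        simpa using (continuous_neg (G := ℝ)).tendsto 0
      exact this.mono_left nhdsWithin_le_nhds
    · filter_upwards [self_mem_nhdsWithin] with s hs
      exact ⟨hs.1, neg_ne_zero.2 hs.2⟩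
  refine (((h.tendsto_log hv hv1).comp hneg).neg).congr' ?_
  filter_upwards [self_mem_nhdsWithin] with s hs
  rw [hB v hv s hs.1, Function.comp_apply, inv_neg]
  ring

theorem integral_eq_log_inverse {v : TangentBundle I M} (hv : v ∈ S) (hv1 : ‖v.2‖ = 1) {t : ℝ}
    (ht : -t ∈ J v.1) :
    IntervalIntegrable (fun s ↦ -D (normalize (A (-s) v))) MeasureTheory.volume 0 t ∧
      Real.log ‖(B t v).2‖ = ∫ s in (0 : ℝ)..t, -D (normalize (A (-s) v)) := by
  obtain ⟨h1, h2⟩ := h.integral_eq_log hv hv1 ht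
  constructor
  · have := (IntervalIntegrable.iff_comp_neg (by simp)).1 h1
    rw [neg_zero, neg_neg] at this
    exact this.neg
  · rw [hB v hv t ht, h2, intervalIntegral.integral_neg,
      intervalIntegral.integral_comp_neg (fun s ↦ D (normalize (A s v))), neg_zero,
      intervalIntegral.integral_symm]

/-- $B_t$ sends $A_t v/\|A_t v\|$ to $v/\|A_t v\|$, whose logarithmic norm is $-\ln\|A_t v\|$. -/
theorem integral_eq_log_inverse_normalize {v : TangentBundle I M} (hv : v ∈ S)
    (hv1 : ‖v.2‖ = 1) {t : ℝ} (ht : t ∈ J v.1) :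
    IntervalIntegrable (fun s ↦ -D (normalize (A s v))) MeasureTheory.volume 0 t ∧
      Real.log ‖(B t (normalize (A t v))).2‖ = ∫ s in (0 : ℝ)..t, -D (normalize (A s v)) := by
  have hP := h.isPartialFlow
  obtain ⟨h1, h2⟩ := h.integral_eq_log hv hv1 ht
  have h3 := hP.neg_mem_and_map_neg hv ht
  refine ⟨h1.neg, ?_⟩
  rw [hB _ (h.normalize_mem (hP.map_mem hv ht)) t h3.1, LinearPoincareFlow.normalize,
    h.map_smul _ (hP.map_mem hv ht), h3.2, intervalIntegral.integral_neg, ← h2, norm_smul, hv1,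
    norm_inv, norm_norm, mul_one, Real.log_inv]

end IsRateOf

end Cocycle

/-! ### The squared norm and the projection orthogonal to the field. -/

section Riemannian

variable {E : Type*} [NormedAddCommGroup E] [NormedSpace ℝ E]
  {H : Type*} [TopologicalSpace H] {I : ModelWithCorners ℝ E H}
  {M : Type*} [TopologicalSpace M] [ChartedSpace H M]
  [RiemannianBundle (fun x : M ↦ TangentSpace I x)]

variable (I M) in
/-- The squared norm of a tangent vector. -/
noncomputable def normSq (v : TangentBundle I M) : ℝ := ‖v.2‖ ^ 2

theorem contMDiff_normSq [IsManifold I ∞ M]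
    [IsContMDiffRiemannianBundle I ∞ E (fun x : M ↦ TangentSpace I x)] :
    ContMDiff I.tangent 𝓘(ℝ) 1 (normSq I M) := by
  have : IsManifold I 1 M := isManifold_one_of_infty
  have : IsContMDiffRiemannianBundle I 1 E (fun x : M ↦ TangentSpace I x) := inferInstance
  have h : ContMDiff I.tangent 𝓘(ℝ) 1 (fun v : TangentBundle I M ↦ inner ℝ v.2 v.2) :=
    ContMDiff.inner_bundle (IB := I) (F := E) (E := fun x : M ↦ TangentSpace I x)
      (b := fun v : TangentBundle I M ↦ v.1) (v := fun v ↦ v.2) (w := fun v ↦ v.2)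
      contMDiff_id contMDiff_id
  refine h.congr fun v ↦ ?_
  rw [normSq, real_inner_self_eq_norm_sq]

theorem normalProj_eq (G : (x : M) → TangentSpace I x) (v : TangentBundle I M) :
    normalProj G v = ⟨v.1, v.2 - (inner ℝ (G v.1) v.2 / ‖G v.1‖ ^ 2) • G v.1⟩ := by
  rw [normalProj, Submodule.starProjection_orthogonal_val, Submodule.starProjection_singleton]
  rfl

theorem inner_normalProj (G : (x : M) → TangentSpace I x) {v : TangentBundle I M}
    (hv : G v.1 ≠ 0) : inner ℝ (normalProj G v).2 (G v.1) = 0 := by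
  have : ‖G v.1‖ ≠ 0 := norm_ne_zero_iff.2 hv
  rw [normalProj_eq, inner_sub_left, real_inner_smul_left, real_inner_self_eq_norm_sq,
    real_inner_comm v.2]
  field_simp
  ring

theorem norm_sq_normalProj (G : (x : M) → TangentSpace I x) {v : TangentBundle I M}
    (hv : G v.1 ≠ 0) :
    ‖(normalProj G v).2‖ ^ 2 = ‖v.2‖ ^ 2 - (inner ℝ v.2 (G v.1)) ^ 2 / ‖G v.1‖ ^ 2 := by
  have : ‖G v.1‖ ≠ 0 := norm_ne_zero_iff.2 hv
  rw [normalProj_eq, norm_sub_sq_real, real_inner_smul_right, norm_smul, Real.norm_eq_abs, mul_pow,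
    sq_abs, real_inner_comm v.2]
  field_simp
  ring

theorem normalProj_of_inner_eq_zero (G : (x : M) → TangentSpace I x) {v : TangentBundle I M}
    (hv : inner ℝ v.2 (G v.1) = 0) : normalProj G v = v := by
  rw [normalProj_eq, real_inner_comm, hv, zero_div, zero_smul, sub_zero]

theorem normalProj_add_smul (G : (x : M) → TangentSpace I x) (v : TangentBundle I M) (c : ℝ) :
    normalProj G ⟨v.1, v.2 + c • G v.1⟩ = normalProj G v := by
  by_cases hG : G v.1 = 0
  · simp [hG]
  · have : ‖G v.1‖ ≠ 0 := norm_ne_zero_iff.2 hG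
    rw [normalProj_eq, normalProj_eq]
    simp only
    congr 1
    rw [inner_add_right, real_inner_smul_right, real_inner_self_eq_norm_sq, add_div,
      mul_div_cancel_right₀ _ (pow_ne_zero 2 this), add_smul]
    abel

theorem normalProj_smul (G : (x : M) → TangentSpace I x) (v : TangentBundle I M) (c : ℝ) :
    normalProj G ⟨v.1, c • v.2⟩ = ⟨v.1, c • (normalProj G v).2⟩ := by
  simp only [normalProj, map_smul]
  rfl

theorem exists_eq_normalProj_add (G : (x : M) → TangentSpace I x) (v : TangentBundle I M) :
    ∃ (w : TangentSpace I v.1) (c : ℝ), normalProj G v = ⟨v.1, w⟩ ∧ v = ⟨v.1, w + c • G v.1⟩ :=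
  ⟨_, inner ℝ (G v.1) v.2 / ‖G v.1‖ ^ 2, normalProj_eq G v, by rw [sub_add_cancel]⟩

end Riemannian

/-! ### The derivative of the flow on fibres and the linear Poincaré flow. -/

section FlowDerivLinear

variable {E : Type*} [NormedAddCommGroup E] [NormedSpace ℝ E]
  {H : Type*} [TopologicalSpace H] {I : ModelWithCorners ℝ E H}
  {M : Type*} [TopologicalSpace M] [ChartedSpace H M]

/-- The derivative of the flow at a point. -/
noncomputable def flowDerivAt (G : (x : M) → TangentSpace I x) (φ : ℝ → M → M) (t : ℝ) (x : M) :
    TangentSpace I x →L[ℝ] TangentSpace I (φ t x) :=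
  mfderivWithin I I (φ t) {x | t ∈ flowDomain G x} x

theorem flowDeriv_eq (G : (x : M) → TangentSpace I x) (φ : ℝ → M → M) (t : ℝ)
    (v : TangentBundle I M) : flowDeriv G φ t v = ⟨φ t v.1, flowDerivAt G φ t v.1 v.2⟩ := rfl

end FlowDerivLinear

section PoincareFlow

variable {E : Type*} [NormedAddCommGroup E] [NormedSpace ℝ E] [FiniteDimensional ℝ E]
  {H : Type*} [TopologicalSpace H] {I : ModelWithCorners ℝ E H}
  {M : Type*} [TopologicalSpace M] [ChartedSpace H M] [IsManifold I ∞ M]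
  [T2Space M] [CompactSpace M]
  {G : (x : M) → TangentSpace I x}
  (hG : ContMDiff I I.tangent 1 (fun x ↦ (⟨x, G x⟩ : TangentBundle I M)))
  {φ : ℝ → M → M} (hφ : IsFlowOf G φ)

include hG hφ

theorem flowDerivAt_field {x : M} {t : ℝ} (ht : t ∈ flowDomain G x) :
    flowDerivAt G φ t x (G x) = G (φ t x) := by
  have := hφ.flowDeriv_field hG ht
  rw [flowDeriv_eq] at this
  simpa using this

theorem flowDerivAt_eq_zero_iff {x : M} {t : ℝ} (ht : t ∈ flowDomain G x) {v : TangentSpace I x} :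
    flowDerivAt G φ t x v = 0 ↔ v = 0 := by
  refine ⟨fun h ↦ ?_, fun h ↦ by rw [h, map_zero]⟩
  have hP := hφ.isPartialFlow_flowDeriv hG
  have h1 : flowDeriv G φ t ⟨x, v⟩ = flowDeriv G φ t ⟨x, 0⟩ := by
    rw [flowDeriv_eq, flowDeriv_eq, h, map_zero]
  have h2 := (hP.bijOn t).injOn (x₁ := ⟨x, v⟩) (x₂ := ⟨x, 0⟩) ⟨mem_univ _, ht⟩
    ⟨mem_univ _, ht⟩ h1
  simpa using h2

/-- $D\phi_t$ is injective and carries $G$ to $G$, so orbits of regular points stay regular. -/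
theorem field_ne_zero_iff {x : M} {t : ℝ} (ht : t ∈ flowDomain G x) :
    G (φ t x) ≠ 0 ↔ G x ≠ 0 := by
  rw [← flowDerivAt_field hG hφ ht, ne_eq, flowDerivAt_eq_zero_iff hG hφ ht]

theorem isPartialFlow_flowDeriv_ne_zero :
    IsPartialFlow {v : TangentBundle I M | v.2 ≠ 0} (fun v : TangentBundle I M ↦ flowDomain G v.1)
      (flowDeriv G φ) :=
  (hφ.isPartialFlow_flowDeriv hG).restrict (subset_univ _) fun v _ t ht ↦
    (flowDerivAt_eq_zero_iff hG hφ (hφ.mem_flowDomain v.1 t ht)).not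

variable [RiemannianBundle (fun x : M ↦ TangentSpace I x)]

/-- $D\phi_t$ preserves the line spanned by $G$, so the component along $G$ removed before applying
it would be removed by the projection afterwards. Thus $P^t$ is the map induced by $D\phi_t$ modulo
$G$, and its flow laws descend from those of $D\phi_t$. -/
theorem poincare_normalProj {v : TangentBundle I M} {t : ℝ} (ht : t ∈ flowDomain G v.1) :
    poincare G φ t (normalProj G v) = normalProj G (flowDeriv G φ t v) := by
  obtain ⟨w, c, h1, h2⟩ := exists_eq_normalProj_add G v
  have h3 : flowDerivAt G φ t v.1 (w + c • G v.1) =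
      flowDerivAt G φ t v.1 w + c • G (φ t v.1) := by
    rw [map_add, map_smul, flowDerivAt_field hG hφ ht]
  have h4 : flowDeriv G φ t v = ⟨φ t v.1, flowDerivAt G φ t v.1 w + c • G (φ t v.1)⟩ := by
    rw [← h3]
    exact (congrArg (flowDeriv G φ t) h2).trans (flowDeriv_eq G φ t _)
  rw [h4, poincare, h1]
  exact (normalProj_add_smul G ⟨φ t v.1, flowDerivAt G φ t v.1 w⟩ c).symm

/-- The linear Poincaré flow is a partial flow on the normal bundle. -/
theorem isPartialFlow_poincare :
    IsPartialFlow (normalBundle G) (fun v : TangentBundle I M ↦ flowDomain G v.1)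
      (poincare G φ) := by
  have hM := hφ.isPartialFlow hG
  have hP := hφ.isPartialFlow_flowDeriv hG
  have hnP {v : TangentBundle I M} (hv : v ∈ normalBundle G) : normalProj G v = v :=
    normalProj_of_inner_eq_zero G hv.2
  have hpos (x : M) {t : ℝ} (ht : 0 ≤ t) : t ∈ flowDomain G x :=
    hM.mem_of_nonneg x (mem_univ _) t ht
  exact
    { mem_of_nonneg := fun v _ t ht ↦ hpos v.1 ht
      mapsTo := fun v hv t ht ↦ by
        have h0 : G (φ t v.1) ≠ 0 := (field_ne_zero_iff hG hφ (hpos v.1 ht)).2 hv.1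
        exact ⟨h0, inner_normalProj G (v := flowDeriv G φ t v) h0⟩
      map_zero := fun v hv ↦ by rw [poincare, hP.map_zero v (mem_univ _), hnP hv]
      map_add := fun v _ s t hs ht ↦ by
        rw [poincare, hP.map_add v (mem_univ _) s t hs ht,
          ← poincare_normalProj hG hφ (hpos _ hs)]
        rfl
      neg_mem := fun v _ s hs ↦ hM.neg_mem v.1 (mem_univ _) s hs
      map_neg := fun v hv s hs ↦ by
        rw [poincare.eq_def G φ s v, poincare_normalProj hG hφ (v := flowDeriv G φ s v)
          (hM.neg_mem v.1 (mem_univ _) s hs), hP.map_neg v (mem_univ _) s hs, hnP hv]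
      exists_of_neg_mem := fun v hv s hs h ↦ by
        obtain ⟨w, -, hw⟩ := hP.exists_of_neg_mem v (mem_univ _) s hs h
        have h0 : G w.1 ≠ 0 := by
          refine (field_ne_zero_iff hG hφ (hpos w.1 hs)).1 ?_
          rw [← hw] at hv
          exact hv.1
        refine ⟨normalProj G w, ⟨h0, inner_normalProj G h0⟩, ?_⟩
        rw [poincare_normalProj hG hφ (hpos w.1 hs), hw, hnP hv] }

theorem poincare_eq_zero_iff {v : TangentBundle I M} (hv : v ∈ normalBundle G) {t : ℝ}
    (ht : t ∈ flowDomain G v.1) : (poincare G φ t v).2 = 0 ↔ v.2 = 0 := by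
  have hP := isPartialFlow_poincare hG hφ
  have hz (x : M) : poincare G φ t ⟨x, 0⟩ = ⟨φ t x, 0⟩ := by
    rw [poincare, flowDeriv_eq, map_zero, normalProj]
    simp
  have h0 : (⟨v.1, 0⟩ : TangentBundle I M) ∈ normalBundle G := ⟨hv.1, inner_zero_left _⟩
  constructor
  · intro h
    have h1 : poincare G φ t v = poincare G φ t ⟨v.1, 0⟩ := by
      rw [hz]
      exact congrArg (TotalSpace.mk (φ t v.1)) h
    have h2 := (hP.bijOn t).injOn ⟨hv, ht⟩ ⟨h0, ht⟩ h1
    rw [h2]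
  · intro h
    have h1 : v = ⟨v.1, 0⟩ := congrArg (TotalSpace.mk v.1) h
    rw [h1, hz]

theorem isPartialFlow_poincare_ne_zero :
    IsPartialFlow {v : TangentBundle I M | v ∈ normalBundle G ∧ v.2 ≠ 0}
      (fun v : TangentBundle I M ↦ flowDomain G v.1) (poincare G φ) := by
  have hP := isPartialFlow_poincare hG hφ
  refine hP.restrict (fun v hv ↦ hv.1) fun v hv t ht ↦ ?_
  have h1 := poincare_eq_zero_iff hG hφ hv (hφ.mem_flowDomain v.1 t ht)
  exact and_congr (iff_of_true (hP.mapsTo v hv t ht) hv) h1.not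

end PoincareFlow

/-! ### The common generator. -/

section Rate

variable {E : Type*} [NormedAddCommGroup E] [NormedSpace ℝ E] [FiniteDimensional ℝ E]
  {H : Type*} [TopologicalSpace H] {I : ModelWithCorners ℝ E H}
  {M : Type*} [TopologicalSpace M] [ChartedSpace H M] [IsManifold I ∞ M]
  [T2Space M] [CompactSpace M]
  [RiemannianBundle (fun x : M ↦ TangentSpace I x)]
  [IsContMDiffRiemannianBundle I ∞ E (fun x : M ↦ TangentSpace I x)]
  {G : (x : M) → TangentSpace I x}
  (hG : ContMDiff I I.tangent 1 (fun x ↦ (⟨x, G x⟩ : TangentBundle I M)))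
  {φ : ℝ → M → M} (hφ : IsFlowOf G φ)

/-- The logarithmic growth rate of the norm of a unit tangent vector under the flow. -/
noncomputable def logRate (G : (x : M) → TangentSpace I x) (φ : ℝ → M → M)
    (v : TangentBundle I M) : ℝ := flowRate G φ (normSq I M) v / 2

include hG hφ

theorem continuous_logRate : Continuous (logRate G φ) :=
  (continuous_flowRate hG hφ contMDiff_normSq).div_const 2

/-- The metric is continuous, so unit vectors near a point have bounded fibre coordinates and the
coordinate bound on the rate applies; compactness of $M$ makes the local bounds uniform. -/
theorem exists_abs_logRate_le :
    ∃ C : ℝ, ∀ v : TangentBundle I M, ‖v.2‖ = 1 → |logRate G φ v| ≤ C := by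
  suffices h : ∃ C : ℝ, ∀ v : TangentBundle I M, v.1 ∈ (univ : Set M) → ‖v.2‖ = 1 →
      |flowRate G φ (normSq I M) v| ≤ C by
    obtain ⟨C, hC⟩ := h
    refine ⟨C / 2, fun v hv ↦ ?_⟩
    rw [logRate, abs_div, abs_two]
    have := hC v (mem_univ _) hv
    gcongr
  refine isCompact_univ.induction_on (p := fun s : Set M ↦ ∃ C : ℝ, ∀ v : TangentBundle I M,
    v.1 ∈ s → ‖v.2‖ = 1 → |flowRate G φ (normSq I M) v| ≤ C) ⟨0, by simp⟩ ?_ ?_ ?_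
  · rintro s t hst ⟨C, hC⟩
    exact ⟨C, fun v hv ↦ hC v (hst hv)⟩
  · rintro s t ⟨C, hC⟩ ⟨C', hC'⟩
    refine ⟨max C C', fun v hv hv1 ↦ ?_⟩
    rcases hv with hv | hv
    exacts [(hC v hv hv1).trans (le_max_left _ _), (hC' v hv hv1).trans (le_max_right _ _)]
  · intro x₀ _
    have : IsManifold I 1 M := isManifold_one_of_infty
    obtain ⟨U, hU, hUb⟩ := exists_abs_flowRate_le hG hφ (contMDiff_normSq (I := I) (M := M)) x₀
    have : IsContinuousRiemannianBundle E (fun x : M ↦ TangentSpace I x) := by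
      obtain ⟨g, hg, hgi⟩ := IsContMDiffRiemannianBundle.exists_contMDiff (IB := I) (n := ∞)
        (F := E) (E := fun x : M ↦ TangentSpace I x)
      exact ⟨g, hg.continuous, hgi⟩
    obtain ⟨R, -, hR⟩ := eventually_norm_trivializationAt_lt E (fun x : M ↦ TangentSpace I x) x₀
    obtain ⟨C, hC⟩ := hUb R
    have hbase : (trivializationAt E (TangentSpace I) x₀).baseSet ∈ 𝓝 x₀ :=
      (trivializationAt E (TangentSpace I) x₀).open_baseSet.mem_nhds
        (mem_baseSet_trivializationAt E (TangentSpace I) x₀)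
    refine ⟨_, mem_nhdsWithin_of_mem_nhds (inter_mem hU (inter_mem hR hbase)), C,
      fun v hv hv1 ↦ hC v hv.1 ?_⟩
    have h1 := ((trivializationAt E (TangentSpace I) x₀).continuousLinearMapAt ℝ v.1).le_opNorm v.2
    rw [hv1, mul_one, Trivialization.continuousLinearMapAt_apply,
      Trivialization.linearMapAt_apply, if_pos hv.2.2] at h1
    exact h1.trans (le_of_lt hv.2.1)

theorem hasDerivWithinAt_norm_sq_flowDeriv (v : TangentBundle I M) :
    HasDerivWithinAt (fun s ↦ ‖(flowDeriv G φ s v).2‖ ^ 2) (2 * logRate G φ v)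
      (flowDomain G v.1) 0 := by
  have h := hasDerivWithinAt_comp_flowDeriv_zero hG hφ (contMDiff_normSq (I := I) (M := M)) v
  refine h.congr_deriv ?_
  rw [logRate]
  ring

theorem isRateOf_flowDeriv :
    IsRateOf {v : TangentBundle I M | v.2 ≠ 0} (flowDomain G) (flowDeriv G φ) (logRate G φ) where
  isPartialFlow := isPartialFlow_flowDeriv_ne_zero hG hφ
  ne_zero v hv := hv
  smul_mem v hv c hc := smul_ne_zero hc hv
  map_smul v hv c t := by
    rw [flowDeriv_eq, flowDeriv_eq, map_smul]
  hasDerivWithinAt_sq v _ _ := hasDerivWithinAt_norm_sq_flowDeriv hG hφ v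
  bounded := by
    obtain ⟨C, hC⟩ := exists_abs_logRate_le hG hφ
    exact ⟨C, fun v _ ↦ hC v⟩

/-- The inner product of the images of two vectors is differentiable along the flow. -/
theorem exists_hasDerivWithinAt_inner_flowDerivAt (x : M) (v w : TangentSpace I x) :
    ∃ c, HasDerivWithinAt
      (fun s ↦ (inner ℝ (flowDerivAt G φ s x v) (flowDerivAt G φ s x w) : ℝ)) c
      (flowDomain G x) 0 := by
  have h1 := hasDerivWithinAt_norm_sq_flowDeriv hG hφ ⟨x, v + w⟩
  have h2 := hasDerivWithinAt_norm_sq_flowDeriv hG hφ ⟨x, v - w⟩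
  have h (s : ℝ) : (inner ℝ (flowDerivAt G φ s x v) (flowDerivAt G φ s x w) : ℝ) =
      (‖(flowDeriv G φ s ⟨x, v + w⟩).2‖ ^ 2 - ‖(flowDeriv G φ s ⟨x, v - w⟩).2‖ ^ 2) / 4 := by
    change _ = (‖flowDerivAt G φ s x (v + w)‖ ^ 2 - ‖flowDerivAt G φ s x (v - w)‖ ^ 2) / 4
    rw [map_add, map_sub, norm_add_sq_real, norm_sub_sq_real]
    ring
  exact ⟨_, ((h1.sub h2).div_const 4).congr_of_eventuallyEq (Eventually.of_forall h) (h 0)⟩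

/-- By Pythagoras the squared norms under $P^s$ and $D\phi_s$ differ by $\langle D\phi_s
v,G\rangle^2/\|G\|^2$. The inner product is differentiable and vanishes at $s=0$ because $v\perp G$,
so its square has zero derivative there and both flows share one rate. -/
theorem hasDerivWithinAt_norm_sq_poincare {v : TangentBundle I M} (hv : v ∈ normalBundle G) :
    HasDerivWithinAt (fun s ↦ ‖(poincare G φ s v).2‖ ^ 2) (2 * logRate G φ v)
      (flowDomain G v.1) 0 := by
  have hP := hφ.isPartialFlow_flowDeriv hG
  have h0 : (0 : ℝ) ∈ flowDomain G v.1 := hφ.mem_flowDomain v.1 0 le_rfl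
  have h1 := hasDerivWithinAt_norm_sq_flowDeriv hG hφ v
  obtain ⟨c, hc⟩ := exists_hasDerivWithinAt_inner_flowDerivAt hG hφ v.1 v.2 (G v.1)
  have h2 := hasDerivWithinAt_norm_sq_flowDeriv hG hφ ⟨v.1, G v.1⟩
  have hq0 : (inner ℝ (flowDerivAt G φ 0 v.1 v.2) (flowDerivAt G φ 0 v.1 (G v.1)) : ℝ) = 0 := by
    rw [flowDerivAt_field hG hφ h0]
    change (inner ℝ (flowDeriv G φ 0 v).2 (G (flowDeriv G φ 0 v).1) : ℝ) = 0
    rw [hP.map_zero v (mem_univ _)]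
    exact hv.2
  have hn0 : ‖(flowDeriv G φ 0 ⟨v.1, G v.1⟩).2‖ ^ 2 ≠ 0 := by
    rw [hP.map_zero _ (mem_univ _)]
    exact pow_ne_zero 2 (norm_ne_zero_iff.2 hv.1)
  have heq (s : ℝ) (hs : s ∈ flowDomain G v.1) : ‖(poincare G φ s v).2‖ ^ 2 =
      ‖(flowDeriv G φ s v).2‖ ^ 2 -
        (inner ℝ (flowDerivAt G φ s v.1 v.2) (flowDerivAt G φ s v.1 (G v.1)) : ℝ) ^ 2 /
          ‖(flowDeriv G φ s ⟨v.1, G v.1⟩).2‖ ^ 2 := by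
    have hne : G (φ s v.1) ≠ 0 := (field_ne_zero_iff hG hφ hs).2 hv.1
    rw [hφ.flowDeriv_field hG hs, flowDerivAt_field hG hφ hs]
    exact norm_sq_normalProj G (v := flowDeriv G φ s v) hne
  refine ((h1.sub ((hc.pow 2).div h2 hn0)).congr heq (heq 0 h0)).congr_deriv ?_
  simp [hq0]

theorem isRateOf_poincare :
    IsRateOf {v : TangentBundle I M | v ∈ normalBundle G ∧ v.2 ≠ 0} (flowDomain G) (poincare G φ)
      (logRate G φ) where
  isPartialFlow := isPartialFlow_poincare_ne_zero hG hφ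
  ne_zero v hv := hv.2
  smul_mem v hv c hc := by
    refine ⟨⟨hv.1.1, ?_⟩, smul_ne_zero hc hv.2⟩
    have := hv.1.2
    simp only [real_inner_smul_left, this, mul_zero]
  map_smul v hv c t := by
    have h1 : flowDeriv G φ t ⟨v.1, c • v.2⟩ =
        ⟨(flowDeriv G φ t v).1, c • (flowDeriv G φ t v).2⟩ := by
      rw [flowDeriv_eq, flowDeriv_eq, map_smul]
    rw [poincare, h1]
    exact normalProj_smul G (flowDeriv G φ t v) c
  hasDerivWithinAt_sq v hv _ := hasDerivWithinAt_norm_sq_poincare hG hφ hv.1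
  bounded := by
    obtain ⟨C, hC⟩ := exists_abs_logRate_le hG hφ
    exact ⟨C, fun v _ ↦ hC v⟩

omit [RiemannianBundle (fun x : M ↦ TangentSpace I x)]
  [IsContMDiffRiemannianBundle I ∞ E (fun x : M ↦ TangentSpace I x)] in
theorem flowDerivInv_eq {w : TangentBundle I M} {t : ℝ} (ht : -t ∈ flowDomain G w.1) :
    flowDerivInv G φ t w = flowDeriv G φ (-t) w := by
  have := (hφ.isPartialFlow_flowDeriv hG).inverseOn_eq (mem_univ w) ht
  simpa [flowDerivInv] using this

omit [IsContMDiffRiemannianBundle I ∞ E (fun x : M ↦ TangentSpace I x)] in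
theorem poincareInv_eq {w : TangentBundle I M} (hw : w ∈ normalBundle G) {t : ℝ}
    (ht : -t ∈ flowDomain G w.1) : poincareInv G φ t w = poincare G φ (-t) w :=
  (isPartialFlow_poincare hG hφ).inverseOn_eq hw ht

end Rate

theorem mainTheorem12
    {E : Type*} [NormedAddCommGroup E] [NormedSpace ℝ E] [FiniteDimensional ℝ E]
    {H : Type*} [TopologicalSpace H] {I : ModelWithCorners ℝ E H}
    {M : Type*} [TopologicalSpace M] [ChartedSpace H M] [IsManifold I ∞ M]
    [T2Space M] [CompactSpace M]
    [RiemannianBundle (fun x : M ↦ TangentSpace I x)]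
    [IsContMDiffRiemannianBundle I ∞ E (fun x : M ↦ TangentSpace I x)]
    (G : (x : M) → TangentSpace I x)
    (hG : ContMDiff I I.tangent 1 (fun x ↦ (⟨x, G x⟩ : TangentBundle I M)))
    (φ : ℝ → M → M) (hφ : IsFlowOf G φ) :
    -- `φ_t` is differentiable, and `Dφ_t` and `P^t` are bijective on their domains
    (∀ t : ℝ,
      MDifferentiableOn I I (φ t) {x | t ∈ flowDomain G x} ∧
      BijOn (flowDeriv G φ t) {v | t ∈ flowDomain G v.1} {w | -t ∈ flowDomain G w.1} ∧
      BijOn (poincare G φ t) {v | v ∈ normalBundle G ∧ t ∈ flowDomain G v.1}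
        {w | w ∈ normalBundle G ∧ -t ∈ flowDomain G w.1}) ∧
    -- the generator of `ln ‖Dφ_t v‖`
    (∃ D_G : TangentBundle I M → ℝ,
      ContinuousOn D_G (unitTangentBundle I M) ∧
      (∃ C : ℝ, ∀ v ∈ unitTangentBundle I M, |D_G v| ≤ C) ∧
      (∀ v ∈ unitTangentBundle I M,
        Tendsto (fun h : ℝ ↦ h⁻¹ * Real.log ‖(flowDeriv G φ h v).2‖)
          (𝓝[{h | h ∈ flowDomain G v.1 ∧ h ≠ 0}] 0) (𝓝 (D_G v))) ∧
      (∀ v ∈ unitTangentBundle I M, ∀ t ∈ flowDomain G v.1,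
        IntervalIntegrable (fun s ↦ D_G (unitFlow G φ s v)) MeasureTheory.volume 0 t ∧
        Real.log ‖(flowDeriv G φ t v).2‖ = ∫ s in (0 : ℝ)..t, D_G (unitFlow G φ s v))) ∧
    -- the generator of `ln ‖Dφ_t⁻¹ v‖`
    (∃ D_G' : TangentBundle I M → ℝ,
      ContinuousOn D_G' (unitTangentBundle I M) ∧
      (∃ C : ℝ, ∀ v ∈ unitTangentBundle I M, |D_G' v| ≤ C) ∧
      (∀ v ∈ unitTangentBundle I M,
        Tendsto (fun h : ℝ ↦ h⁻¹ * Real.log ‖(flowDerivInv G φ h v).2‖)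
          (𝓝[{h | -h ∈ flowDomain G v.1 ∧ h ≠ 0}] 0) (𝓝 (D_G' v))) ∧
      (∀ v ∈ unitTangentBundle I M, ∀ t : ℝ, -t ∈ flowDomain G v.1 →
        IntervalIntegrable (fun s ↦ D_G' (unitFlow G φ (-s) v)) MeasureTheory.volume 0 t ∧
        Real.log ‖(flowDerivInv G φ t v).2‖ = ∫ s in (0 : ℝ)..t, D_G' (unitFlow G φ (-s) v)) ∧
      (∀ v ∈ unitTangentBundle I M, ∀ t ∈ flowDomain G v.1,
        IntervalIntegrable (fun s ↦ D_G' (unitFlow G φ s v)) MeasureTheory.volume 0 t ∧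
        Real.log ‖(flowDerivInv G φ t (unitFlow G φ t v)).2‖ =
          ∫ s in (0 : ℝ)..t, D_G' (unitFlow G φ s v))) ∧
    -- the generator of `ln ‖P^t v‖`
    (∃ D : TangentBundle I M → ℝ,
      ContinuousOn D (unitTangentBundle I M ∩ normalBundle G) ∧
      (∃ C : ℝ, ∀ v ∈ unitTangentBundle I M ∩ normalBundle G, |D v| ≤ C) ∧
      (∀ v ∈ unitTangentBundle I M ∩ normalBundle G,
        Tendsto (fun h : ℝ ↦ h⁻¹ * Real.log ‖(poincare G φ h v).2‖)
          (𝓝[{h | h ∈ flowDomain G v.1 ∧ h ≠ 0}] 0) (𝓝 (D v))) ∧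
      (∀ v ∈ unitTangentBundle I M ∩ normalBundle G, ∀ t ∈ flowDomain G v.1,
        IntervalIntegrable (fun s ↦ D (unitNormalFlow G φ s v)) MeasureTheory.volume 0 t ∧
        Real.log ‖(poincare G φ t v).2‖ = ∫ s in (0 : ℝ)..t, D (unitNormalFlow G φ s v))) ∧
    -- the generator of `ln ‖(P^t)⁻¹ v‖`
    (∃ D' : TangentBundle I M → ℝ,
      ContinuousOn D' (unitTangentBundle I M ∩ normalBundle G) ∧
      (∃ C : ℝ, ∀ v ∈ unitTangentBundle I M ∩ normalBundle G, |D' v| ≤ C) ∧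
      (∀ v ∈ unitTangentBundle I M ∩ normalBundle G,
        Tendsto (fun h : ℝ ↦ h⁻¹ * Real.log ‖(poincareInv G φ h v).2‖)
          (𝓝[{h | -h ∈ flowDomain G v.1 ∧ h ≠ 0}] 0) (𝓝 (D' v))) ∧
      (∀ v ∈ unitTangentBundle I M ∩ normalBundle G, ∀ t : ℝ, -t ∈ flowDomain G v.1 →
        IntervalIntegrable (fun s ↦ D' (unitNormalFlow G φ (-s) v)) MeasureTheory.volume 0 t ∧
        Real.log ‖(poincareInv G φ t v).2‖ =
          ∫ s in (0 : ℝ)..t, D' (unitNormalFlow G φ (-s) v)) ∧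
      (∀ v ∈ unitTangentBundle I M ∩ normalBundle G, ∀ t ∈ flowDomain G v.1,
        IntervalIntegrable (fun s ↦ D' (unitNormalFlow G φ s v)) MeasureTheory.volume 0 t ∧
        Real.log ‖(poincareInv G φ t (unitNormalFlow G φ t v)).2‖ =
          ∫ s in (0 : ℝ)..t, D' (unitNormalFlow G φ s v))) := by
  have hF := isRateOf_flowDeriv hG hφ
  have hFB (w : TangentBundle I M) (_ : w ∈ {v : TangentBundle I M | v.2 ≠ 0}) (t : ℝ)
      (ht : -t ∈ flowDomain G w.1) : flowDerivInv G φ t w = flowDeriv G φ (-t) w :=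
    flowDerivInv_eq hG hφ ht
  have hN := isRateOf_poincare hG hφ
  have hNB (w : TangentBundle I M) (hw : w ∈ {v : TangentBundle I M | v ∈ normalBundle G ∧ v.2 ≠ 0})
      (t : ℝ) (ht : -t ∈ flowDomain G w.1) : poincareInv G φ t w = poincare G φ (-t) w :=
    poincareInv_eq hG hφ hw.1 ht
  have hunit {v : TangentBundle I M} (hv : ‖v.2‖ = 1) : v.2 ≠ 0 := by
    rintro h
    rw [h, norm_zero] at hv
    exact zero_ne_one hv
  have hc := continuous_logRate hG hφ
  obtain ⟨C, hC⟩ := exists_abs_logRate_le hG hφ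
  -- The witnesses are `logRate` for $D_G$ and $D$, and its negative for $\tilde D_G$ and $\tilde
  -- D$; continuity and the bound are inherited from the whole tangent bundle and all unit vectors.
  refine ⟨fun t ↦ ⟨hφ.mdifferentiableOn hG t, ?_, (isPartialFlow_poincare hG hφ).bijOn t⟩,
    ⟨logRate G φ, hc.continuousOn, ⟨C, fun v hv ↦ hC v hv⟩,
      fun v hv ↦ hF.tendsto_log (hunit hv) hv,
      fun v hv t ht ↦ hF.integral_eq_log (hunit hv) hv ht⟩,
    ⟨fun v ↦ -logRate G φ v, hc.neg.continuousOn,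
      ⟨C, fun v hv ↦ (abs_neg _).trans_le (hC v hv)⟩,
      fun v hv ↦ hF.tendsto_log_inverse hFB (hunit hv) hv,
      fun v hv t ht ↦ hF.integral_eq_log_inverse hFB (hunit hv) hv ht,
      fun v hv t ht ↦ hF.integral_eq_log_inverse_normalize hFB (hunit hv) hv ht⟩,
    ⟨logRate G φ, hc.continuousOn, ⟨C, fun v hv ↦ hC v hv.1⟩,
      fun v hv ↦ hN.tendsto_log ⟨hv.2, hunit hv.1⟩ hv.1,
      fun v hv t ht ↦ hN.integral_eq_log ⟨hv.2, hunit hv.1⟩ hv.1 ht⟩,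
    ⟨fun v ↦ -logRate G φ v, hc.neg.continuousOn,
      ⟨C, fun v hv ↦ (abs_neg _).trans_le (hC v hv.1)⟩,
      fun v hv ↦ hN.tendsto_log_inverse hNB ⟨hv.2, hunit hv.1⟩ hv.1,
      fun v hv t ht ↦ hN.integral_eq_log_inverse hNB ⟨hv.2, hunit hv.1⟩ hv.1 ht,
      fun v hv t ht ↦ hN.integral_eq_log_inverse_normalize hNB ⟨hv.2, hunit hv.1⟩ hv.1 ht⟩⟩
  simpa using (hφ.isPartialFlow_flowDeriv hG).bijOn t
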